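/- **Setting.** Let $\omega>0$ and $\mu$ be real, let $\ell$ be a positive integer, and put $T=2\pi/\omega$, $\lambda=(2\omega)^{-2}-\mu^2$. Let $S=\{z\in\mathbb C:|z|=1,\ z\ne-1\}$; its two ends are denoted $e^{i\pi}$ (limit at $-1$ from the upper half-plane) and $e^{-i\pi}$ (from the lower half-plane). All functions of $z$ are considered in some vicinity (an open neighbourhood) of $S$. Consider, for holomorphic $\Phi,\Psi$, the equations and constraints $$\Phi'=(2i\omega z)^{-1}(1-\Phi^2)+\bigl(\ell z^{-1}+\mu(1+z^{-2})\bigr)\Phi,\tag{1}$$ $$2i\omega z\,\Psi'=(\Phi+\Phi^{-1})\Psi,\tag{2}$$ $$\Psi(1)=1,\qquad |\Phi(1)|=1.\tag{3}$$ **Polynomials.** Let $p_0=0$, $q_0=1$, $r_0=z^{-2}$, $s_0=-\mu$ and, for $k\ge1$, $$p_k=(1-\ell)z\,p_{k-1}+q_{k-1}+z^2p_{k-1}',\qquad q_k=z^2(-\lambda+(\ell+1)\mu z)p_{k-1}+\mu(1-z^2)q_{k-1}+z^2q_{k-1}',$$ $$r_k=2(k-2)z\,r_{k-1}-s_{k-1}-z^2r_{k-1}',\qquad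 s_k=z^2(\lambda-(\ell+1)\mu z)r_{k-1}+\bigl((2k-\ell-3)z+\mu(z^2-1)\bigr)s_{k-1}-z^2s_{k-1}'.$$ Put $\mathfrak p=p_\ell$, $\mathfrak q=q_\ell$, $\mathfrak r=r_\ell$, $\mathfrak s=s_\ell$ and $\mathfrak D_\pm=\mathfrak p(1)\pm2\omega\,\mathfrak r(1)$. **The transformation $B$.** Given $(\Phi,\Psi)$ satisfying (1)–(3), let $\varphi:[-T/2,T/2]\to\mathbb R$ be continuous with $\Phi(e^{i\omega t})=e^{i\varphi(t)}$ for $|t|<T/2$, and let $P(t)=\int_0^t\cos\varphi$. Let $\Phi^{1/2},\Psi^{1/2}$ be the holomorphic square roots near $S$ that equal $e^{i\varphi(t)/2}$, $e^{P(t)/2}$ at $e^{i\omega t}$, and let $\Phi^{-1/2}=1/\Phi^{1/2}$. Put $X=e^{P(T/2)/2}$, $Y=e^{P(-T/2)/2}$, $\varphi_0=\varphi(0)$, $\varphi_\pm=\varphi(\pm T/2)$, $$u_\pm=(-1)^\ell e^{i\varphi_+/2}\pm i e^{-i\varphi_+/2},\quad v_\pm=e^{i\varphi_- /2}\pm i(-1)^\ell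 e^{-i\varphi_- /2},\quad w_\pm=e^{i\varphi_0/2}\pm i e^{-i\varphi_0/2},$$ $$A=2iX(\mathfrak D_+w_-u_-+\mathfrak D_-w_+u_+),\qquad C=-\mathfrak D_+w_-(Xu_-+Yv_-)+\mathfrak D_-w_+(Xu_++Yv_+),$$ $$N(z)=A\,\Psi(z)^{1/2}\Phi(z)^{1/2}+C\,\Psi(1/z)^{1/2}\Phi(1/z)^{-1/2},\qquad D(z)=-A\,\Psi(z)^{1/2}\Phi(z)^{-1/2}+C\,\Psi(1/z)^{1/2}\Phi(1/z)^{1/2},$$ $$F=\mathfrak D_-w_+\bigl((2\sin\varphi_0-1)Xu_+-Yv_+\bigr)+\mathfrak D_+w_-\bigl((2\sin\varphi_0+1)Xu_-+Yv_-\bigr),$$ $$G=-\mathfrak D_-w_+\bigl((\sin\varphi_0-2)Xu_++\sin\varphi_0\,Yv_+\bigr)+\mathfrak D_+w_-\bigl((\sin\varphi_0+2)Xu_-+\sin\varphi_0\,Yv_-\bigr).$$ Define $$\Phi_B(z)=-\frac{N(z)}{D(z)},\qquad \Theta_B(z)=\frac{-iF\,\Psi(z)^{1/2}\Phi(z)^{-1/2}+G\,\Psi(1/z)^{1/2}\Phi(1/z)^{1/2}}{\cos\varphi_0\;D(z)},$$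 $$\tilde\Theta_B(z)=\frac{iF\,\Psi(z)^{1/2}\Phi(z)^{1/2}+G\,\Psi(1/z)^{1/2}\Phi(1/z)^{-1/2}}{\cos\varphi_0\;N(z)},\qquad \Psi_B(z)=\frac{2i}{\Theta_B(z)-\tilde\Theta_B(z)}.$$ **The monodromy transformation $M$.** $M(\Phi,\Psi)=(\Phi_M,\Psi_M)$, where $\Phi_M$ is the solution of (1) near $S$ with $\Phi_M(e^{-i\pi})=\Phi(e^{i\pi})$, and $\Psi_M$ is the solution of (2) for $\Phi_M$ with $\Psi_M(1)=1$ such that, for some nonzero constant $\kappa$, $\kappa\Psi_M(e^{-i\pi})=\Psi(e^{i\pi})$ (boundary values are limits along $S$). **Theorem.** Assume $\mathfrak D_+\ne0\ne\mathfrak D_-$. Let $(\Phi,\Psi)$ satisfy (1)–(3) in a vicinity of $S$, with $\Phi(1)^2\ne-1$. Then the data $\varphi,\Phi^{1/2},\Psi^{1/2}$ exist, and for any choice of them: * $(\Phi_B,\Psi_B)$ again satisfies (1), (2) and (3) in a vicinity of $S$; * if moreover $\Phi_B(1)^2\ne-1$ (so that $B$ can be applied to $(\Phi_B,\Psi_B)$),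 then $B$ applied twice coincides with the monodromy transformation: $B(B(\Phi,\Psi))=M(\Phi,\Psi)$ in a vicinity of $S$ (in particular $M(\Phi,\Psi)$ exists and is unique there). -/

import Mathlib

open Filter Topology Set

noncomputable section

namespace RSJ

/-! ### The polynomials `𝔭, 𝔮, 𝔯, 𝔰` -/

/-- The parameter `λ = (2ω)⁻² - μ²`. -/
def lam (ω μ : ℝ) : ℝ := ((2 * ω) ^ 2)⁻¹ - μ ^ 2

/-- The sequences `(p_k, q_k)` of functions of `z`. -/
def pqSeq (ω μ : ℝ) (l : ℕ) : ℕ → (ℂ → ℂ) × (ℂ → ℂ)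
  | 0 => (fun _ => 0, fun _ => 1)
  | n + 1 =>
    let p := (pqSeq ω μ l n).1;
    let q := (pqSeq ω μ l n).2;
    (fun z => (1 - (l : ℂ)) * z * p z + q z + z ^ 2 * deriv p z,
     fun z => z ^ 2 * (-(lam ω μ : ℂ) + ((l : ℂ) + 1) * (μ : ℂ) * z) * p z
        + (μ : ℂ) * (1 - z ^ 2) * q z + z ^ 2 * deriv q z)

/-- The sequences `(r_k, s_k)` of functions of `z` (considered for `z ≠ 0`; `r_0 = z⁻²`). -/
def rsSeq (ω μ : ℝ) (l : ℕ) : ℕ → (ℂ → ℂ) × (ℂ → ℂ)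
  | 0 => (fun z => (z ^ 2)⁻¹, fun _ => -(μ : ℂ))
  | n + 1 =>
    let r := (rsSeq ω μ l n).1;
    let s := (rsSeq ω μ l n).2;
    let k : ℂ := (n : ℂ) + 1;
    (fun z => 2 * (k - 2) * z * r z - s z - z ^ 2 * deriv r z,
     fun z => z ^ 2 * ((lam ω μ : ℂ) - ((l : ℂ) + 1) * (μ : ℂ) * z) * r z
        + ((2 * k - (l : ℂ) - 3) * z + (μ : ℂ) * (z ^ 2 - 1)) * s z - z ^ 2 * deriv s z)

/-- The diagonal representative `𝔭 = p_ℓ`. -/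
def polyP (ω μ : ℝ) (l : ℕ) : ℂ → ℂ := (pqSeq ω μ l l).1

/-- The diagonal representative `𝔮 = q_ℓ`. -/
def polyQ (ω μ : ℝ) (l : ℕ) : ℂ → ℂ := (pqSeq ω μ l l).2

/-- The diagonal representative `𝔯 = r_ℓ`. -/
def polyR (ω μ : ℝ) (l : ℕ) : ℂ → ℂ := (rsSeq ω μ l l).1

/-- The diagonal representative `𝔰 = s_ℓ`. -/
def polyS (ω μ : ℝ) (l : ℕ) : ℂ → ℂ := (rsSeq ω μ l l).2

/-- `𝔇₊ = 𝔭(1) + 2ω 𝔯(1)`. -/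
def Dplus (ω μ : ℝ) (l : ℕ) : ℂ := polyP ω μ l 1 + 2 * (ω : ℂ) * polyR ω μ l 1

/-- `𝔇₋ = 𝔭(1) - 2ω 𝔯(1)`. -/
def Dminus (ω μ : ℝ) (l : ℕ) : ℂ := polyP ω μ l 1 - 2 * (ω : ℂ) * polyR ω μ l 1

/-! ### The equations, on a vicinity of the punctured unit circle -/

/-- The unit circle without the point `-1`. -/
def puncturedCircle : Set ℂ := {z | ‖z‖ = 1 ∧ z ≠ -1}

/-- The period `T = 2π/ω`. -/
def period (ω : ℝ) : ℝ := 2 * Real.pi / ω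

/-- The point `e^{iωt}` of the unit circle. For `-T/2 < t < T/2` these are the points of the
punctured circle. -/
def circlePoint (ω t : ℝ) : ℂ := Complex.exp (Complex.I * (ω : ℂ) * (t : ℂ))

/-- `Φ` is a holomorphic solution, on some open set containing the punctured circle, of
`Φ' = (2iωz)⁻¹ (1 - Φ²) + (ℓ z⁻¹ + μ (1 + z⁻²)) Φ`. -/
def IsRiccatiSolution (ω μ : ℝ) (l : ℕ) (Φ : ℂ → ℂ) : Prop :=
  ∀ᶠ z in 𝓝ˢ puncturedCircle,
    HasDerivAt Φ ((2 * Complex.I * (ω : ℂ) * z)⁻¹ * (1 - Φ z ^ 2)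
      + ((l : ℂ) * z⁻¹ + (μ : ℂ) * (1 + (z ^ 2)⁻¹)) * Φ z) z

/-- `Ψ` is a holomorphic solution, on some open set containing the punctured circle, of
`2iωz Ψ' = (Φ + Φ⁻¹) Ψ`. -/
def IsLinearSolution (ω : ℝ) (Φ Ψ : ℂ → ℂ) : Prop :=
  ∀ᶠ z in 𝓝ˢ puncturedCircle, Φ z ≠ 0 ∧ ∃ d : ℂ, HasDerivAt Ψ d z ∧
    2 * Complex.I * (ω : ℂ) * z * d = (Φ z + (Φ z)⁻¹) * Ψ z

/-- The two equations together with the constraints `Ψ(1) = 1` and `|Φ(1)| = 1`. -/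
structure IsSolutionPair (ω μ : ℝ) (l : ℕ) (Φ Ψ : ℂ → ℂ) : Prop where
  riccati : IsRiccatiSolution ω μ l Φ
  linear : IsLinearSolution ω Φ Ψ
  psi_one : Ψ 1 = 1
  norm_phi_one : ‖Φ 1‖ = 1

/-! ### The monodromy transformation -/

/-- The boundary value of `f` at `e^{iπ}` (the end of the punctured circle in the upper
half-plane) equals the boundary value of `g` at `e^{-iπ}` (the end in the lower half-plane). -/
def ContinuesTo (ω : ℝ) (f g : ℂ → ℂ) : Prop :=
  ∃ c : ℂ, Tendsto (fun t : ℝ => f (circlePoint ω t)) (𝓝[<] (period ω / 2)) (𝓝 c) ∧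
    Tendsto (fun t : ℝ => g (circlePoint ω t)) (𝓝[>] (-(period ω / 2))) (𝓝 c)

/-- `(Φ_M, Ψ_M)` is the image of `(Φ, Ψ)` under the monodromy transformation:
`Φ_M` is the solution with `Φ_M(e^{-iπ}) = Φ(e^{iπ})`, and `Ψ_M` is the solution of the linear
equation for `Φ_M` obtained by continuing `Ψ` in the same way and normalising the result by a
constant factor so that `Ψ_M(1) = 1`. -/
structure IsMonodromyImage (ω μ : ℝ) (l : ℕ) (Φ Ψ ΦM ΨM : ℂ → ℂ) : Prop where
  riccati : IsRiccatiSolution ω μ l ΦM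
  continues_phi : ContinuesTo ω Φ ΦM
  linear : IsLinearSolution ω ΦM ΨM
  continues_psi : ∃ κ : ℂ, κ ≠ 0 ∧ ContinuesTo ω Ψ (fun z => κ * ΨM z)
  psi_one : ΨM 1 = 1

/-! ### The functions `φ`, `P` and the half-powers -/

/-- `P(t) = ∫₀ᵗ cos φ`. -/
def phaseIntegral (φ : ℝ → ℝ) (t : ℝ) : ℝ := ∫ τ in (0 : ℝ)..t, Real.cos (φ τ)

/-- `h` is the holomorphic square root of `f`, in a vicinity of the punctured circle, that takes
the values `g t` at the points `e^{iωt}`, `-T/2 < t < T/2`. -/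
def IsHalfPower (ω : ℝ) (f : ℂ → ℂ) (g : ℝ → ℂ) (h : ℂ → ℂ) : Prop :=
  (∀ᶠ z in 𝓝ˢ puncturedCircle, AnalyticAt ℂ h z ∧ h z ^ 2 = f z) ∧
    ∀ t ∈ Ioo (-(period ω / 2)) (period ω / 2), h (circlePoint ω t) = g t

/-- The auxiliary functions entering the `B`-transformation: the real phase `φ` and the
half-powers `Φ^{1/2}`, `Ψ^{1/2}`. -/
structure Branches where
  phase : ℝ → ℝ
  rootPhi : ℂ → ℂ
  rootPsi : ℂ → ℂ

/-- `φ` is continuous with `Φ(e^{iωt}) = e^{iφ(t)}` (its values at `±T/2` being the limits), and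
the half-powers are the analytic continuations of `e^{iφ(t)/2}` and `e^{P(t)/2}`. -/
structure Branches.IsFor (b : Branches) (ω : ℝ) (Φ Ψ : ℂ → ℂ) : Prop where
  phase_cont : ContinuousOn b.phase (Icc (-(period ω / 2)) (period ω / 2))
  phase_eq : ∀ t ∈ Ioo (-(period ω / 2)) (period ω / 2),
    Φ (circlePoint ω t) = Complex.exp (Complex.I * (b.phase t : ℂ))
  rootPhi_eq : IsHalfPower ω Φ (fun t => Complex.exp (Complex.I * (b.phase t : ℂ) / 2)) b.rootPhi
  rootPsi_eq : IsHalfPower ω Ψ (fun t => Complex.exp ((phaseIntegral b.phase t : ℂ) / 2)) b.rootPsi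

/-! ### The `B`-transformation -/

/-- `e^{P(T/2)/2}`. -/
def ePplus (ω : ℝ) (b : Branches) : ℂ :=
  Complex.exp ((phaseIntegral b.phase (period ω / 2) : ℂ) / 2)

/-- `e^{P(-T/2)/2}`. -/
def ePminus (ω : ℝ) (b : Branches) : ℂ :=
  Complex.exp ((phaseIntegral b.phase (-(period ω / 2)) : ℂ) / 2)

/-- `e^{iφ(t)/2}`. -/
def ePhase (b : Branches) (t : ℝ) : ℂ := Complex.exp (Complex.I * (b.phase t : ℂ) / 2)

/-- `e^{-iφ(t)/2}`. -/
def ePhaseInv (b : Branches) (t : ℝ) : ℂ := Complex.exp (-(Complex.I * (b.phase t : ℂ) / 2))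

/-- `u₊` for `σ = 1` and `u₋` for `σ = -1`. -/
def coefU (ω : ℝ) (l : ℕ) (b : Branches) (σ : ℂ) : ℂ :=
  (-1) ^ l * ePhase b (period ω / 2) + σ * Complex.I * ePhaseInv b (period ω / 2)

/-- `v₊` for `σ = 1` and `v₋` for `σ = -1`. -/
def coefV (ω : ℝ) (l : ℕ) (b : Branches) (σ : ℂ) : ℂ :=
  ePhase b (-(period ω / 2)) + σ * Complex.I * (-1) ^ l * ePhaseInv b (-(period ω / 2))

/-- `w₊` for `σ = 1` and `w₋` for `σ = -1`. -/
def coefW (b : Branches) (σ : ℂ) : ℂ := ePhase b 0 + σ * Complex.I * ePhaseInv b 0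

/-- `Ψ(z)^{1/2} Φ(z)^{1/2}`. -/
def rootMul (b : Branches) (z : ℂ) : ℂ := b.rootPsi z * b.rootPhi z

/-- `Ψ(z)^{1/2} Φ(z)^{-1/2}`. -/
def rootDiv (b : Branches) (z : ℂ) : ℂ := b.rootPsi z * (b.rootPhi z)⁻¹

/-- `2i e^{P(T/2)/2} (𝔇₊ w₋ u₋ + 𝔇₋ w₊ u₊)`. -/
def coefA (ω μ : ℝ) (l : ℕ) (b : Branches) : ℂ :=
  2 * Complex.I * ePplus ω b *
    (Dplus ω μ l * coefW b (-1) * coefU ω l b (-1) + Dminus ω μ l * coefW b 1 * coefU ω l b 1)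

/-- `-𝔇₊ w₋ (e^{P(T/2)/2} u₋ + e^{P(-T/2)/2} v₋) + 𝔇₋ w₊ (e^{P(T/2)/2} u₊ + e^{P(-T/2)/2} v₊)`. -/
def coefB (ω μ : ℝ) (l : ℕ) (b : Branches) : ℂ :=
  -(Dplus ω μ l) * coefW b (-1) * (ePplus ω b * coefU ω l b (-1) + ePminus ω b * coefV ω l b (-1))
    + Dminus ω μ l * coefW b 1 * (ePplus ω b * coefU ω l b 1 + ePminus ω b * coefV ω l b 1)

/-- The numerator of `-Φ_B`. -/
def numB (ω μ : ℝ) (l : ℕ) (b : Branches) (z : ℂ) : ℂ :=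
  coefA ω μ l b * rootMul b z + coefB ω μ l b * rootDiv b (1 / z)

/-- The denominator of `-Φ_B`. -/
def denB (ω μ : ℝ) (l : ℕ) (b : Branches) (z : ℂ) : ℂ :=
  -(coefA ω μ l b) * rootDiv b z + coefB ω μ l b * rootMul b (1 / z)

/-- The function `Φ_B`. -/
def phiB (ω μ : ℝ) (l : ℕ) (b : Branches) (z : ℂ) : ℂ :=
  -(numB ω μ l b z) * (denB ω μ l b z)⁻¹

/-- `sin φ(0)`. -/
def sinPhase (b : Branches) : ℂ := (Real.sin (b.phase 0) : ℂ)

/-- The coefficient at the half-powers of argument `1/z` in the numerators of `Θ_B`, `Θ̃_B`. -/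
def coefTheta (ω μ : ℝ) (l : ℕ) (b : Branches) : ℂ :=
  -(Dminus ω μ l) * coefW b 1 *
      ((sinPhase b - 2) * ePplus ω b * coefU ω l b 1 + sinPhase b * ePminus ω b * coefV ω l b 1)
    + Dplus ω μ l * coefW b (-1) *
      ((sinPhase b + 2) * ePplus ω b * coefU ω l b (-1) + sinPhase b * ePminus ω b * coefV ω l b (-1))

/-- The function `Θ_B`. -/
def thetaB (ω μ : ℝ) (l : ℕ) (b : Branches) (z : ℂ) : ℂ :=
  ((Real.cos (b.phase 0) : ℂ))⁻¹ *
    (-Complex.I *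
        (Dminus ω μ l * coefW b 1 *
            ((2 * sinPhase b - 1) * ePplus ω b * coefU ω l b 1 - ePminus ω b * coefV ω l b 1)
          + Dplus ω μ l * coefW b (-1) *
            ((2 * sinPhase b + 1) * ePplus ω b * coefU ω l b (-1) + ePminus ω b * coefV ω l b (-1)))
        * rootDiv b z
      + coefTheta ω μ l b * rootMul b (1 / z))
    * (denB ω μ l b z)⁻¹

/-- The function `Θ̃_B`. -/
def thetaTildeB (ω μ : ℝ) (l : ℕ) (b : Branches) (z : ℂ) : ℂ :=
  ((Real.cos (b.phase 0) : ℂ))⁻¹ *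
    (Complex.I *
        (-(Dminus ω μ l) * coefW b 1 *
            (-(2 * sinPhase b - 1) * ePplus ω b * coefU ω l b 1 + ePminus ω b * coefV ω l b 1)
          + Dplus ω μ l * coefW b (-1) *
            ((2 * sinPhase b + 1) * ePplus ω b * coefU ω l b (-1) + ePminus ω b * coefV ω l b (-1)))
        * rootMul b z
      + coefTheta ω μ l b * rootDiv b (1 / z))
    * (numB ω μ l b z)⁻¹

/-- The function `Ψ_B`, the reciprocal of `(Θ_B - Θ̃_B)/(2i)`. -/
def psiB (ω μ : ℝ) (l : ℕ) (b : Branches) (z : ℂ) : ℂ :=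
  ((2 * Complex.I)⁻¹ * (thetaB ω μ l b z - thetaTildeB ω μ l b z))⁻¹

/-- `(Φ', Ψ')` is the image `(Φ_B, Ψ_B)` of `(Φ, Ψ)` under the transformation `B`. The phase `φ`
is determined up to a multiple of `2π` and the half-powers up to their values away from the
punctured circle, so the image is a relation; the choices do not matter near the circle. -/
def IsBTransform (ω μ : ℝ) (l : ℕ) (Φ Ψ Φ' Ψ' : ℂ → ℂ) : Prop :=
  ∃ b : Branches, b.IsFor ω Φ Ψ ∧ Φ' = phiB ω μ l b ∧ Ψ' = psiB ω μ l b

end RSJ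

end

/-! The substitution `x = Ψ^{1/2} Φ^{1/2}`, `y = Ψ^{1/2} Φ^{-1/2}` turns (1), (2) into a traceless
linear 2×2 system with `Φ = x/y` and `Ψ = xy` (`IsSolutionPair.isCSys`). Two symmetries of this
system are used. The inversion z ↦ 1/z sends a solution `(x, y)` to `(y(1/z), -x(1/z))`. The
half-period shift t ↦ t + T/2 only changes the sign of the μ-term, and a matrix built from the
Laurent polynomials `alpha`, `beta` repairs this (`IsSys.halfShift`). In essence B is this corrected
half-period shift, up to a scalar. Doing it twice is a shift by a full period, which is the
monodromy.

The matrix works because of the algebra of the polynomials. With q and s replaced by q + μz²p and s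
+ μz²r, both sequences are governed by one connection `pairD` along z² d/dz. A commutator
computation gives r_ℓ, s_ℓ as (-1)^ℓ times the ℓ-th iterate on (1, 0), which closes the system on
the diagonal (`pairD_pqPoly_diag`). The pair (r_k, s_k) is also the coefficient reversal of (p_k,
q_k) (`coeffZ_rsPoly`), so the closed system is a differential equation relating `alpha` and `beta`
at z and 1/z. A recurrence for the coefficients yields the parity needed to evaluate them at -1.

On the circle, `(numB, -denB)` is A times the solution plus C times its inversion. Constancy of
Wronskians (`IsSys.endpoint_relations`) shows that it equals `cB` times the shifted solution both at
t = 0 and at t = -T/2 (`combination_zero`, `combination_end`). The matrices giving these two values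
from (x, y) at T/2 and at 0 are inverse to each other up to 𝔯(1)² - (𝔭(1)/2ω)², a nonzero multiple
of 𝔇₊𝔇₋. So after the second B the value at e^{-iπ} is proportional to the original one at e^{iπ}.

Since y is the conjugate of x on the circle, `denB` is ± the conjugate of `numB`. This gives |Φ_B| =
1, and together with a Wronskian it excludes zeros. Finally Ψ_B collapses to N(z)D(z)/(N(1)D(1)),
and the monodromy image is unique by uniqueness for linear equations. -/

namespace RSJ

/-! ### The connection `pairD` and the closed system for the diagonal polynomials. -/

section

open Polynomial

/-- The connection `(P, Q) ↦ z² (P, Q)' + …` on pairs of polynomials. -/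
noncomputable def pairD (ω μ : ℝ) (l : ℕ) (v : ℝ[X] × ℝ[X]) : ℝ[X] × ℝ[X] :=
  (X ^ 2 * derivative v.1 + ((1 - (l : ℝ[X])) * X - C μ * X ^ 2) * v.1 + v.2,
   X ^ 2 * derivative v.2 + C μ * v.2 - C (((2 * ω) ^ 2)⁻¹) * X ^ 2 * v.1)

/-- The pair `(p_k, q_k + μ z² p_k)` as polynomials. -/
noncomputable def pqPoly (ω μ : ℝ) (l k : ℕ) : ℝ[X] × ℝ[X] := (pairD ω μ l)^[k] (0, 1)

/-- The pair `z² (r_k, s_k + μ z² r_k)` as polynomials. -/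
noncomputable def rsPoly (ω μ : ℝ) (l : ℕ) : ℕ → ℝ[X] × ℝ[X]
  | 0 => (1, 0)
  | k + 1 => -pairD ω μ l (rsPoly ω μ l k)
      + ((2 * (k : ℝ[X]) + 1 - (l : ℝ[X])) * X) • rsPoly ω μ l k

variable {ω μ : ℝ} {l : ℕ}

/-- Leibniz rule: apart from the derivation z² d/dz, every term of `pairD` is linear over ℝ[X]. -/
theorem pairD_smul (a : ℝ[X]) (v : ℝ[X] × ℝ[X]) :
    pairD ω μ l (a • v) = (X ^ 2 * derivative a) • v + a • pairD ω μ l v := by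
  ext1 <;> simp only [pairD, Prod.fst_add, Prod.snd_add, Prod.smul_fst, Prod.smul_snd,
    smul_eq_mul, derivative_mul] <;> ring

theorem pairD_sub (v w : ℝ[X] × ℝ[X]) :
    pairD ω μ l (v - w) = pairD ω μ l v - pairD ω μ l w := by
  ext1 <;> simp only [pairD, Prod.fst_sub, Prod.snd_sub, derivative_sub] <;> ring

theorem pairD_iterate_sub_smul (k : ℕ) (v w : ℝ[X] × ℝ[X]) (c : ℝ) :
    (pairD ω μ l)^[k] (v - (C c : ℝ[X]) • w)
      = (pairD ω μ l)^[k] v - (C c : ℝ[X]) • (pairD ω μ l)^[k] w := by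
  induction k with
  | zero => rfl
  | succ k ih =>
    simp only [Function.iterate_succ', Function.comp, ih, pairD_sub, pairD_smul]
    simp

/-- The commutator of `pairD` with multiplication by X is multiplication by X², by the Leibniz rule.
Moving one factor X through k + 1 applications therefore leaves a single correction term. -/
theorem X_smul_pairD_iterate (k : ℕ) (g : ℝ[X] × ℝ[X]) :
    (X : ℝ[X]) • (pairD ω μ l)^[k + 1] g = (pairD ω μ l)^[k + 1] ((X : ℝ[X]) • g)
      - (((k : ℝ[X]) + 1) * X) • (pairD ω μ l)^[k] ((X : ℝ[X]) • g) := by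
  induction k with
  | zero =>
    simp only [Function.iterate_succ', Function.comp, Function.iterate_zero, id, pairD_smul]
    ext1 <;> simp <;> ring
  | succ k ih =>
    rw [Function.iterate_succ' _ (k + 1)]
    simp only [Function.comp]
    set u := (pairD ω μ l)^[k + 1] g with hu
    have h1 := pairD_smul (ω := ω) (μ := μ) (l := l) X u
    rw [ih, pairD_sub, pairD_smul, ← Function.iterate_succ_apply' (pairD ω μ l) k] at h1
    set G1 := (pairD ω μ l)^[k + 1] ((X : ℝ[X]) • g)
    set G0 := (pairD ω μ l)^[k] ((X : ℝ[X]) • g)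
    have h2 : (X : ℝ[X]) • pairD ω μ l u
        = pairD ω μ l G1 - (X ^ 2 * derivative (((k : ℝ[X]) + 1) * X)) • G0
          - (((k : ℝ[X]) + 1) * X) • G1 - (X : ℝ[X]) • (X : ℝ[X]) • u := by
      rw [eq_comm, ← sub_eq_zero] at h1
      rw [← sub_eq_zero, ← h1]
      simp only [derivative_X, mul_one, pow_two, mul_smul]
      abel
    rw [h2, ih]
    ext1 <;> simp <;> ring

/-- The factor 2k + 1 - ℓ in the recurrence of `rsPoly` is k - j on the line k + 1 + j = ℓ: the
correction k + 1 from `X_smul_pairD_iterate` minus the j + 1 from differentiating X^(j+1). The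
induction compares both sides after multiplication by X, which is injective. The case j = 0 is the
one wanted. -/
theorem X_pow_smul_rsPoly (k j : ℕ) (h : k + j = l) :
    (X ^ j : ℝ[X]) • rsPoly ω μ l k
      = ((-1) ^ k : ℝ[X]) • (pairD ω μ l)^[k] ((X ^ j : ℝ[X]) • (1, 0)) := by
  induction k generalizing j with
  | zero => simp [rsPoly]
  | succ k ih =>
    have ih' := ih (j + 1) (by omega)
    have key := X_smul_pairD_iterate (ω := ω) (μ := μ) (l := l) k ((X ^ j : ℝ[X]) • (1, 0))
    rw [smul_smul, ← pow_succ'] at key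
    have hd : pairD ω μ l ((X ^ (j + 1) : ℝ[X]) • rsPoly ω μ l k)
        = ((-1) ^ k : ℝ[X]) • (pairD ω μ l)^[k + 1] ((X ^ (j + 1) : ℝ[X]) • (1, 0)) := by
      rw [ih', pairD_smul, Function.iterate_succ_apply']
      have : derivative ((-1 : ℝ[X]) ^ k) = 0 := by
        have : ((-1 : ℝ[X]) ^ k) = C ((-1) ^ k) := by simp
        rw [this, derivative_C]
      rw [this]; simp
    rw [pairD_smul] at hd
    have hl : (l : ℝ[X]) = (k : ℝ[X]) + 1 + j := by rw [← h]; push_cast; ring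
    have hX : Function.Injective (fun v : ℝ[X] × ℝ[X] => (X : ℝ[X]) • v) := by
      intro v w hvw
      have h1 := congrArg Prod.fst hvw
      have h2 := congrArg Prod.snd hvw
      simp only [Prod.smul_fst, Prod.smul_snd, smul_eq_mul] at h1 h2
      exact Prod.ext (mul_left_cancel₀ X_ne_zero h1) (mul_left_cancel₀ X_ne_zero h2)
    apply hX
    simp only
    rw [smul_comm X ((-1 : ℝ[X]) ^ (k + 1)), key, rsPoly]
    set G1 := (pairD ω μ l)^[k + 1] ((X ^ (j + 1) : ℝ[X]) • (1, 0))
    set G0 := (pairD ω μ l)^[k] ((X ^ (j + 1) : ℝ[X]) • (1, 0))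
    set r := rsPoly ω μ l k
    have e1 := congrArg Prod.fst hd
    have e2 := congrArg Prod.snd hd
    have f1 := congrArg Prod.fst ih'
    have f2 := congrArg Prod.snd ih'
    simp only [Prod.fst_add, Prod.snd_add, Prod.smul_fst, Prod.smul_snd, smul_eq_mul,
      derivative_X_pow, Nat.cast_add, Nat.cast_one, Nat.add_sub_cancel, map_add, map_natCast,
      map_one] at e1 e2 f1 f2
    ext1
    · simp only [Prod.fst_add, Prod.smul_fst, smul_eq_mul, Prod.fst_sub, Prod.fst_neg, hl]
      linear_combination -e1 + ((k : ℝ[X]) + 1) * X * f1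
    · simp only [Prod.snd_add, Prod.smul_snd, smul_eq_mul, Prod.snd_sub, Prod.snd_neg, hl]
      linear_combination -e2 + ((k : ℝ[X]) + 1) * X * f2

theorem pqPoly_succ (k : ℕ) : pqPoly ω μ l (k + 1) = pairD ω μ l (pqPoly ω μ l k) :=
  Function.iterate_succ_apply' _ _ _

/-- The closed first order system of the diagonal polynomials. -/
theorem pairD_pqPoly_diag :
    pairD ω μ l (pqPoly ω μ l l)
      = (C μ : ℝ[X]) • pqPoly ω μ l l + ((-1) ^ l : ℝ[X]) • rsPoly ω μ l l := by
  have h := X_pow_smul_rsPoly (ω := ω) (μ := μ) (l := l) l 0 (by omega)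
  simp only [pow_zero, one_smul] at h
  -- The starting vector of `rsPoly` is (D - μ) applied to that of `pqPoly`, where D is `pairD`.
  -- Hence D^ℓ(1, 0) = (D - μ) D^ℓ(0, 1).
  have h1 : ((1, 0) : ℝ[X] × ℝ[X]) = pairD ω μ l (0, 1) - (C μ : ℝ[X]) • (0, 1) := by
    ext1 <;> simp [pairD]
  rw [h, smul_smul, ← pow_add, ← two_mul, pow_mul, neg_one_sq, one_pow, one_smul, h1,
    pairD_iterate_sub_smul, ← Function.iterate_succ_apply, Function.iterate_succ_apply']
  simp only [pqPoly]
  abel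

/-! ### Coefficients indexed by integers -/

/-- The coefficients of a polynomial, indexed by the integers. -/
noncomputable def coeffZ (f : ℝ[X]) (n : ℤ) : ℝ := if 0 ≤ n then f.coeff n.toNat else 0

theorem coeffZ_of_neg (f : ℝ[X]) {n : ℤ} (hn : n < 0) : coeffZ f n = 0 := by
  simp [coeffZ, not_le.mpr hn]

theorem coeffZ_natCast (f : ℝ[X]) (n : ℕ) : coeffZ f n = f.coeff n := by simp [coeffZ]

theorem coeffZ_add (f g : ℝ[X]) (n : ℤ) : coeffZ (f + g) n = coeffZ f n + coeffZ g n := by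
  unfold coeffZ; split_ifs <;> simp

theorem coeffZ_sub (f g : ℝ[X]) (n : ℤ) : coeffZ (f - g) n = coeffZ f n - coeffZ g n := by
  unfold coeffZ; split_ifs <;> simp

theorem coeffZ_neg (f : ℝ[X]) (n : ℤ) : coeffZ (-f) n = -coeffZ f n := by
  unfold coeffZ; split_ifs <;> simp

theorem coeffZ_C_mul (c : ℝ) (f : ℝ[X]) (n : ℤ) : coeffZ (C c * f) n = c * coeffZ f n := by
  unfold coeffZ; split_ifs <;> simp

theorem coeffZ_X_mul (f : ℝ[X]) (n : ℤ) : coeffZ (X * f) n = coeffZ f (n - 1) := by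
  rcases lt_or_ge n 0 with h | h
  · rw [coeffZ_of_neg _ h, coeffZ_of_neg _ (by omega)]
  · obtain ⟨m, rfl⟩ := Int.eq_ofNat_of_zero_le h
    cases m with
    | zero => rw [coeffZ_natCast, coeffZ_of_neg _ (by simp)]; simp
    | succ m =>
      rw [show ((m + 1 : ℕ) : ℤ) - 1 = (m : ℤ) by push_cast; ring, coeffZ_natCast, coeffZ_natCast]
      simp

theorem coeffZ_X_sq_mul (f : ℝ[X]) (n : ℤ) : coeffZ (X ^ 2 * f) n = coeffZ f (n - 2) := by
  rw [pow_two, mul_assoc, coeffZ_X_mul, coeffZ_X_mul]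
  congr 1; ring

theorem coeffZ_derivative (f : ℝ[X]) (n : ℤ) :
    coeffZ (derivative f) n = (n + 1) * coeffZ f (n + 1) := by
  rcases lt_or_ge n 0 with h | h
  · rw [coeffZ_of_neg _ h]
    rcases eq_or_lt_of_le (show n + 1 ≤ 0 by omega) with h' | h'
    · have : (n : ℝ) + 1 = 0 := by exact_mod_cast h'
      rw [this, zero_mul]
    · rw [coeffZ_of_neg _ h', mul_zero]
  · obtain ⟨m, rfl⟩ := Int.eq_ofNat_of_zero_le h
    rw [show (m : ℤ) + 1 = ((m + 1 : ℕ) : ℤ) by push_cast; ring, coeffZ_natCast, coeffZ_natCast,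
      coeff_derivative]
    push_cast; ring

theorem coeffZ_pairD_fst (v : ℝ[X] × ℝ[X]) (n : ℤ) :
    coeffZ (pairD ω μ l v).1 n
      = (n - l) * coeffZ v.1 (n - 1) - μ * coeffZ v.1 (n - 2) + coeffZ v.2 n := by
  have h : (pairD ω μ l v).1 = X ^ 2 * derivative v.1 + C (1 - (l : ℝ)) * (X * v.1)
      - C μ * (X ^ 2 * v.1) + v.2 := by
    simp only [pairD, map_sub, map_one, map_natCast]; ring
  rw [h]
  simp only [coeffZ_add, coeffZ_sub, coeffZ_C_mul, coeffZ_X_mul, coeffZ_X_sq_mul,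
    coeffZ_derivative]
  rw [show n - 2 + 1 = n - 1 by ring]
  push_cast; ring

theorem coeffZ_pairD_snd (v : ℝ[X] × ℝ[X]) (n : ℤ) :
    coeffZ (pairD ω μ l v).2 n
      = (n - 1) * coeffZ v.2 (n - 1) + μ * coeffZ v.2 n
        - ((2 * ω) ^ 2)⁻¹ * coeffZ v.1 (n - 2) := by
  have h : (pairD ω μ l v).2 = X ^ 2 * derivative v.2 + C μ * v.2
      - C (((2 * ω) ^ 2)⁻¹) * (X ^ 2 * v.1) := by
    simp only [pairD]; ring
  rw [h]
  simp only [coeffZ_add, coeffZ_sub, coeffZ_C_mul, coeffZ_X_sq_mul, coeffZ_derivative]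
  rw [show n - 2 + 1 = n - 1 by ring]
  push_cast; ring

theorem coeffZ_one (n : ℤ) : coeffZ 1 n = if n = 0 then 1 else 0 := by
  unfold coeffZ
  split_ifs with h1 h2 h2
  · simp [h2]
  · rw [coeff_one, if_neg]; omega
  · omega
  · rfl

theorem coeffZ_zero (n : ℤ) : coeffZ 0 n = 0 := by
  unfold coeffZ; split_ifs <;> simp

/-- Reversal n ↦ 2k - n exchanges the two recurrences: it swaps the roles of p and q, up to the
factor (2ω)⁻², and turns the derivative term into its negative plus a multiple of X. -/
theorem coeffZ_rsPoly (k : ℕ) : ∀ n : ℤ,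
    coeffZ (rsPoly ω μ l k).1 n = coeffZ (pqPoly ω μ l k).2 (2 * k - n) ∧
    coeffZ (rsPoly ω μ l k).2 n = ((2 * ω) ^ 2)⁻¹ * coeffZ (pqPoly ω μ l k).1 (2 * k - n) := by
  induction k with
  | zero =>
    intro n
    simp [rsPoly, pqPoly, coeffZ_one, coeffZ_zero]
  | succ k ih =>
    intro n
    have h2C : (C (2 : ℝ) : ℝ[X]) = 2 := map_ofNat C 2
    have h1 : (rsPoly ω μ l (k + 1)).1 = -(pairD ω μ l (rsPoly ω μ l k)).1
        + C (2 * (k : ℝ) + 1 - l) * (X * (rsPoly ω μ l k).1) := by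
      simp [rsPoly, h2C]; ring
    have h2 : (rsPoly ω μ l (k + 1)).2 = -(pairD ω μ l (rsPoly ω μ l k)).2
        + C (2 * (k : ℝ) + 1 - l) * (X * (rsPoly ω μ l k).2) := by
      simp [rsPoly, h2C]; ring
    rw [h1, h2, pqPoly_succ]
    simp only [coeffZ_add, coeffZ_neg, coeffZ_C_mul, coeffZ_X_mul, coeffZ_pairD_fst,
      coeffZ_pairD_snd, (ih _).1, (ih _).2]
    rw [show (2 * ((k + 1 : ℕ) : ℤ) - n) = 2 * k - n + 2 by push_cast; ring,
      show 2 * (k : ℤ) - n + 2 - 1 = 2 * k - (n - 1) by ring,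
      show 2 * (k : ℤ) - n + 2 - 2 = 2 * k - n by ring,
      show 2 * (k : ℤ) - n + 2 = 2 * k - (n - 2) by ring]
    constructor <;> push_cast <;> ring

/-- A solution `(p, q)` of the coefficient recurrence of the diagonal polynomials is symmetric. -/
theorem coeff_symm_of_recurrence {μ κ : ℝ} (hμ : μ ≠ 0) (p q : ℤ → ℝ)
    (hp : ∀ n < 0, p n = 0)
    (h1 : ∀ n : ℤ, (n - l) * p (n - 1) - μ * (p (n - 2) + p n) + q n
      - (-1) ^ l * q (2 * l - n) = 0)
    (h2 : ∀ n : ℤ, n * q n = κ * (p (n - 1) + (-1) ^ l * p (2 * l - n - 1)))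
    (hκ : κ ≠ 0) (hq : ∀ n < 0, q n = 0) (n : ℤ) :
    p n = (-1) ^ (l + 1) * (-1 : ℝ) ^ n * p (2 * l - 2 - n) := by
  -- Read `h2` at 2ℓ - 1 - m ≤ 0: its left side vanishes, either through the factor n or through q,
  -- and one of the two p-terms has negative index.
  have hb : ∀ m : ℤ, 2 * l - 2 < m → p m = 0 := by
    intro m hm
    have h := h2 (2 * l - 1 - m)
    have hz : ((2 * l - 1 - m : ℤ) : ℝ) * q (2 * l - 1 - m) = 0 := by
      rcases eq_or_lt_of_le (show 2 * (l : ℤ) - 1 - m ≤ 0 by omega) with h' | h'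
      · rw [h']; simp
      · rw [hq _ h', mul_zero]
    rw [hz, hp _ (by omega), show 2 * (l : ℤ) - (2 * l - 1 - m) - 1 = m by ring] at h
    have := (mul_eq_zero.mp h.symm).resolve_left hκ
    rw [zero_add] at this
    exact (mul_eq_zero.mp this).resolve_left (pow_ne_zero _ (by norm_num))
  -- The defect from symmetry; the aim is d = 0.
  set d : ℤ → ℝ := fun n => p n - (-1) ^ (l + 1) * (-1 : ℝ) ^ n * p (2 * l - 2 - n) with hd
  have hsq : ((-1 : ℝ) ^ l) * (-1) ^ l = 1 := by
    rw [← pow_add, ← two_mul, pow_mul]; simp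
  have hsqz : ∀ n : ℤ, ((-1 : ℝ) ^ n) * (-1) ^ n = 1 := by
    intro n; rw [← mul_zpow]; simp
  have hshift : ∀ n : ℤ, (-1 : ℝ) ^ (n - 1) = -(-1) ^ n := by
    intro n; rw [zpow_sub₀ (by norm_num), zpow_one, div_neg, div_one]
  have hshift2 : ∀ n : ℤ, (-1 : ℝ) ^ (n - 2) = (-1) ^ n := by
    intro n; rw [zpow_sub₀ (by norm_num)]; simp
  have hrefl : ∀ n : ℤ, (-1 : ℝ) ^ (2 * l - n) = (-1) ^ n := by
    intro n
    rw [zpow_sub₀ (by norm_num), zpow_mul]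
    rcases Int.even_or_odd n with h | h <;> simp [h.neg_one_zpow]
  -- For odd n the right side of `h2` is κ d(n - 1). The factor 1 - (-1)^n makes the even case void.
  have hodd : ∀ n : ℤ, (1 - (-1 : ℝ) ^ n) * (n * q n - κ * d (n - 1)) = 0 := by
    intro n
    rcases Int.even_or_odd n with h | h
    · simp [h.neg_one_zpow]
    · rw [h2 n, hd]
      simp only [hshift, h.neg_one_zpow]
      rw [show 2 * (l : ℤ) - 2 - (n - 1) = 2 * l - n - 1 by ring]
      ring
  have hds : ∀ n : ℤ, d (2 * l - 2 - n) = (-1) ^ l * (-1 : ℝ) ^ n * d n := by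
    intro n
    simp only [hd]
    rw [show 2 * (l : ℤ) - 2 - (2 * l - 2 - n) = n by ring,
      show 2 * (l : ℤ) - 2 - n = 2 * l - n - 2 by ring, hshift2, hrefl]
    rw [pow_succ]
    linear_combination (-(p (2 * l - n - 2))) * hsq - (-1 : ℝ) ^ l * (-1) ^ l * p (2 * l - n - 2) * hsqz n
  -- Adding to `h1` at n its reflection at 2ℓ - n with the sign (-1)^(ℓ+n) leaves only d and
  -- odd-index values of q, and `hodd` expresses these through d.
  have hrec : ∀ n : ℤ, (n - l) * d (n - 1) - μ * (d (n - 2) + d n) + (1 - (-1 : ℝ) ^ n) * q n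
      - (-1) ^ l * ((1 - (-1 : ℝ) ^ n) * q (2 * l - n)) = 0 := by
    intro n
    have e1 := h1 n
    have e2 := h1 (2 * l - n)
    simp only [hd]
    rw [show 2 * (l : ℤ) - (2 * l - n) = n by ring] at e2
    rw [show 2 * (l : ℤ) - 2 - (n - 1) = 2 * l - n - 1 by ring,
      show 2 * (l : ℤ) - 2 - (n - 2) = 2 * l - n by ring,
      show 2 * (l : ℤ) - 2 - n = 2 * l - n - 2 by ring, hshift, hshift2]
    push_cast at e2
    rw [pow_succ]
    linear_combination e1 + (-1) ^ l * (-1 : ℝ) ^ n * e2 + (-1 : ℝ) ^ n * q n * hsq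
  -- Induction from the left: once d vanishes below N, both q-terms in `hrec` vanish and μ d(N) = 0
  -- remains.
  have hzero : ∀ N : ℕ, ∀ n : ℤ, n < N → d n = 0 := by
    intro N
    induction N with
    | zero =>
      intro n hn
      simp only [hd]
      rw [hp n (by simpa using hn), hb _ (by push_cast at hn; omega)]; simp
    | succ N ih =>
      intro n hn
      rcases lt_or_eq_of_le (show n ≤ N by push_cast at hn; omega) with h | rfl
      · exact ih n h
      · have r := hrec N
        rw [ih _ (by omega), ih _ (by omega)] at r
        have q1 : (1 - (-1 : ℝ) ^ (N : ℤ)) * q N = 0 := by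
          have := hodd N
          rw [ih _ (by omega)] at this
          rcases Int.even_or_odd (N : ℤ) with h | h
          · simp [h.neg_one_zpow]
          · have hne : ((N : ℤ) : ℝ) ≠ 0 := by
              have : (N : ℤ) ≠ 0 := by rintro h0; rw [h0] at h; simp at h
              exact_mod_cast this
            rw [h.neg_one_zpow] at this ⊢
            have h3 : ((N : ℤ) : ℝ) * q N = 0 := by linarith
            rw [(mul_eq_zero.mp h3).resolve_left hne, mul_zero]
        have q2 : (1 - (-1 : ℝ) ^ (N : ℤ)) * q (2 * l - N) = 0 := by
          have := hodd (2 * l - N)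
          rw [show (2 * (l : ℤ) - N) - 1 = 2 * l - 2 - (N - 1) by ring, hds, ih _ (by omega),
            hrefl] at this
          rcases Int.even_or_odd (N : ℤ) with h | h
          · simp [h.neg_one_zpow]
          · have hne : ((2 * l - N : ℤ) : ℝ) ≠ 0 := by
              have : (2 * l - N : ℤ) ≠ 0 := by
                obtain ⟨m, hm⟩ := h
                omega
              exact_mod_cast this
            rw [h.neg_one_zpow] at this ⊢
            have h3 : ((2 * l - N : ℤ) : ℝ) * q (2 * l - N) = 0 := by linarith
            rw [(mul_eq_zero.mp h3).resolve_left hne, mul_zero]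
        rw [q1, q2] at r
        have : μ * d N = 0 := by linarith
        exact (mul_eq_zero.mp this).resolve_left hμ
  have := hzero (n.toNat + 1) n (by omega)
  simp only [hd] at this
  linarith

end

/-! ### Parity of the coefficients, and the passage from coefficients to functions of z. -/

section

open Polynomial

variable {ω μ : ℝ} {l : ℕ}

/-- For μ = 0 the recurrence is homogeneous in z, so p_k and q_k are monomials. This covers the case
in which the recurrence for the defect cannot be solved. -/
theorem coeffZ_pqPoly_of_mu_eq_zero (k : ℕ) : ∀ n : ℤ,
    (n ≠ k - 1 → coeffZ (pqPoly ω 0 l k).1 n = 0) ∧ (n ≠ k → coeffZ (pqPoly ω 0 l k).2 n = 0) := by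
  induction k with
  | zero =>
    intro n
    simp [pqPoly, coeffZ_zero, coeffZ_one]
  | succ k ih =>
    intro n
    rw [pqPoly_succ, coeffZ_pairD_fst, coeffZ_pairD_snd]
    refine ⟨fun h => ?_, fun h => ?_⟩
    · rw [(ih (n - 1)).1 (by push_cast at h; omega), (ih n).2 (by push_cast at h; omega)]; simp
    · rw [(ih (n - 1)).2 (by push_cast at h; omega), (ih (n - 2)).1 (by push_cast at h; omega)]; simp

theorem coeffZ_diag_fst (n : ℤ) :
    (n - l) * coeffZ (pqPoly ω μ l l).1 (n - 1)
      - μ * (coeffZ (pqPoly ω μ l l).1 (n - 2) + coeffZ (pqPoly ω μ l l).1 n)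
      + coeffZ (pqPoly ω μ l l).2 n - (-1) ^ l * coeffZ (pqPoly ω μ l l).2 (2 * l - n) = 0 := by
  have h := congrArg (fun v => coeffZ v.1 n) (pairD_pqPoly_diag (ω := ω) (μ := μ) (l := l))
  have hC : ((-1) ^ l : ℝ[X]) = C ((-1) ^ l) := by simp
  simp only [coeffZ_pairD_fst, Prod.fst_add, Prod.smul_fst, smul_eq_mul, coeffZ_add, hC,
    coeffZ_C_mul, (coeffZ_rsPoly l n).1] at h
  linarith

theorem coeffZ_diag_snd (n : ℤ) :
    n * coeffZ (pqPoly ω μ l l).2 n = ((2 * ω) ^ 2)⁻¹ * (coeffZ (pqPoly ω μ l l).1 (n - 1)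
      + (-1) ^ l * coeffZ (pqPoly ω μ l l).1 (2 * l - n - 1)) := by
  have h := congrArg (fun v => coeffZ v.2 (n + 1))
    (pairD_pqPoly_diag (ω := ω) (μ := μ) (l := l))
  have hC : ((-1) ^ l : ℝ[X]) = C ((-1) ^ l) := by simp
  simp only [coeffZ_pairD_snd, Prod.snd_add, Prod.smul_snd, smul_eq_mul, coeffZ_add, hC,
    coeffZ_C_mul, (coeffZ_rsPoly l _).2] at h
  rw [show n + 1 - 1 = n by ring, show n + 1 - 2 = n - 1 by ring,
    show 2 * (l : ℤ) - (n + 1) = 2 * l - n - 1 by ring] at h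
  push_cast at h
  linarith

theorem coeffZ_diag_fst_symm (hω : ω ≠ 0) (n : ℤ) :
    coeffZ (pqPoly ω μ l l).1 n
      = (-1) ^ (l + 1) * (-1 : ℝ) ^ n * coeffZ (pqPoly ω μ l l).1 (2 * l - 2 - n) := by
  by_cases hμ : μ = 0
  · subst hμ
    by_cases hn : n = l - 1
    · have hs : (-1 : ℝ) ^ (l + 1) * (-1 : ℝ) ^ n = 1 := by
        rw [← zpow_natCast, ← zpow_add₀ (by norm_num), hn]
        apply Even.neg_one_zpow
        exact ⟨l, by push_cast; ring⟩
      rw [hs, one_mul, show 2 * (l : ℤ) - 2 - n = n by omega]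
    · rw [(coeffZ_pqPoly_of_mu_eq_zero l n).1 hn,
        (coeffZ_pqPoly_of_mu_eq_zero l (2 * l - 2 - n)).1 (by omega), mul_zero]
  · exact coeff_symm_of_recurrence hμ _ _ (fun n hn => coeffZ_of_neg _ hn) coeffZ_diag_fst
      coeffZ_diag_snd (by positivity) (fun n hn => coeffZ_of_neg _ hn) n

theorem coeffZ_diag_snd_odd (hω : ω ≠ 0) {n : ℤ} (hn : Odd n) :
    coeffZ (pqPoly ω μ l l).2 n = 0 := by
  have h := coeffZ_diag_snd (ω := ω) (μ := μ) (l := l) n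
  rw [coeffZ_diag_fst_symm hω (n - 1), show 2 * (l : ℤ) - 2 - (n - 1) = 2 * l - n - 1 by ring,
    Even.neg_one_zpow (by rcases hn with ⟨m, hm⟩; exact ⟨m, by omega⟩), pow_succ] at h
  have hne : (n : ℝ) ≠ 0 := by
    have : n ≠ 0 := by rintro rfl; simp at hn
    exact_mod_cast this
  have h0 : (n : ℝ) * coeffZ (pqPoly ω μ l l).2 n = 0 := by rw [h]; ring
  exact (mul_eq_zero.mp h0).resolve_left hne

theorem natDegree_le_of_coeffZ {f : ℝ[X]} {N : ℕ} (h : ∀ n : ℤ, N < n → coeffZ f n = 0) :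
    f.natDegree ≤ N :=
  natDegree_le_iff_coeff_eq_zero.mpr fun n hn => by
    rw [← coeffZ_natCast]; exact h n (by exact_mod_cast hn)

/-- Reflection into integer indices already bounds both degrees by N, because coefficients of
negative index are zero; for g this needs c ≠ 0. -/
theorem aeval_of_coeffZ_reflect {f g : ℝ[X]} {N : ℕ} {c : ℝ} (hc : c ≠ 0)
    (h : ∀ n : ℤ, coeffZ f n = c * coeffZ g (N - n)) {z : ℂ} (hz : z ≠ 0) :
    aeval z f = c * z ^ N * aeval z⁻¹ g := by
  have hf : f.natDegree ≤ N := natDegree_le_of_coeffZ fun n hn => by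
    rw [h, coeffZ_of_neg _ (by omega), mul_zero]
  have hg : g.natDegree ≤ N := natDegree_le_of_coeffZ fun n hn => by
    have := h (N - n)
    rw [coeffZ_of_neg _ (by omega), show (N : ℤ) - (N - n) = n by ring] at this
    exact (mul_eq_zero.mp this.symm).resolve_left hc
  rw [aeval_eq_sum_range' (Nat.lt_succ_of_le hf), aeval_eq_sum_range' (Nat.lt_succ_of_le hg),
    ← Finset.sum_range_reflect, Finset.mul_sum]
  refine Finset.sum_congr rfl fun i hi => ?_
  have hi : i ≤ N := by simpa [Nat.lt_succ_iff] using hi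
  rw [show N.succ - 1 - i = N - i by omega, ← coeffZ_natCast, h, ← coeffZ_natCast g,
    Nat.cast_sub hi, show (N : ℤ) - (N - i) = i by ring, pow_sub₀ _ hz hi]
  simp only [Complex.real_smul]
  push_cast
  rw [inv_pow]; ring

theorem aeval_rsPoly_fst {k : ℕ} {z : ℂ} (hz : z ≠ 0) :
    aeval z (rsPoly ω μ l k).1 = z ^ (2 * k) * aeval z⁻¹ (pqPoly ω μ l k).2 := by
  have := aeval_of_coeffZ_reflect (f := (rsPoly ω μ l k).1) (g := (pqPoly ω μ l k).2)
    (N := 2 * k) one_ne_zero (fun n => by rw [(coeffZ_rsPoly k n).1]; push_cast; ring) hz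
  simpa using this

theorem aeval_rsPoly_snd (hω : ω ≠ 0) {k : ℕ} {z : ℂ} (hz : z ≠ 0) :
    aeval z (rsPoly ω μ l k).2
      = ((2 * (ω : ℂ)) ^ 2)⁻¹ * z ^ (2 * k) * aeval z⁻¹ (pqPoly ω μ l k).1 := by
  have := aeval_of_coeffZ_reflect (f := (rsPoly ω μ l k).2) (g := (pqPoly ω μ l k).1)
    (N := 2 * k) (c := ((2 * ω) ^ 2)⁻¹) (by positivity)
    (fun n => by rw [(coeffZ_rsPoly k n).2]; push_cast; ring) hz
  simpa using this

theorem pqSeq_eq (k : ℕ) :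
    (pqSeq ω μ l k).1 = (fun z : ℂ => aeval z (pqPoly ω μ l k).1) ∧
    (pqSeq ω μ l k).2 = (fun z : ℂ => aeval z (pqPoly ω μ l k).2
      - (μ : ℂ) * z ^ 2 * aeval z (pqPoly ω μ l k).1) := by
  induction k with
  | zero => simp [pqSeq, pqPoly]
  | succ k ih =>
    -- Passing from q to q + μz²p adds μ² to λ, so that only (2ω)⁻² remains in `pairD`.
    have hl : (lam ω μ : ℂ) = ((2 * (ω : ℂ)) ^ 2)⁻¹ - (μ : ℂ) ^ 2 := by simp [lam]
    have hP : ∀ z : ℂ, HasDerivAt (fun z => aeval z (pqPoly ω μ l k).1)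
        (aeval z (derivative (pqPoly ω μ l k).1)) z := fun z => Polynomial.hasDerivAt_aeval _ z
    have hQ : ∀ z : ℂ, HasDerivAt (fun z => aeval z (pqPoly ω μ l k).2)
        (aeval z (derivative (pqPoly ω μ l k).2)) z := fun z => Polynomial.hasDerivAt_aeval _ z
    have hq : ∀ z : ℂ, HasDerivAt (fun z : ℂ => aeval z (pqPoly ω μ l k).2
        - μ * z ^ 2 * aeval z (pqPoly ω μ l k).1) _ z := fun z =>
      (hQ z).sub ((((hasDerivAt_id z).pow 2).const_mul (μ : ℂ)).mul (hP z))
    simp only [pqSeq]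
    rw [ih.1, ih.2, pqPoly_succ]
    refine ⟨funext fun z => ?_, funext fun z => ?_⟩
    · simp only [(hP z).deriv, pairD, map_add, map_sub, map_mul, map_pow, aeval_X, aeval_C,
        map_one, map_natCast, Complex.coe_algebraMap]
      ring
    · simp only [(hq z).deriv, pairD, map_add, map_sub, map_mul, map_pow, aeval_X, aeval_C,
        map_one, map_natCast, Complex.coe_algebraMap, id, Pi.pow_apply]
      rw [hl]
      push_cast
      ring

theorem rsSeq_eq (hω : ω ≠ 0) (k : ℕ) : ∀ z : ℂ, z ≠ 0 →
    (rsSeq ω μ l k).1 z = (z ^ 2)⁻¹ * aeval z (rsPoly ω μ l k).1 ∧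
    (rsSeq ω μ l k).2 z = (z ^ 2)⁻¹ * aeval z (rsPoly ω μ l k).2
      - μ * aeval z (rsPoly ω μ l k).1 := by
  induction k with
  | zero => simp [rsSeq, rsPoly]
  | succ k ih =>
    intro z hz
    have hl : (lam ω μ : ℂ) = ((2 * (ω : ℂ)) ^ 2)⁻¹ - (μ : ℂ) ^ 2 := by simp [lam]
    have hR : HasDerivAt (fun z => aeval z (rsPoly ω μ l k).1)
        (aeval z (derivative (rsPoly ω μ l k).1)) z := Polynomial.hasDerivAt_aeval _ z
    have hS : HasDerivAt (fun z => aeval z (rsPoly ω μ l k).2)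
        (aeval z (derivative (rsPoly ω μ l k).2)) z := Polynomial.hasDerivAt_aeval _ z
    have hi : HasDerivAt (fun z : ℂ => (z ^ 2)⁻¹) _ z :=
      ((hasDerivAt_id z).pow 2).inv (by simpa using hz)
    have hev : ∀ᶠ w in 𝓝 z, w ≠ 0 := isOpen_ne.mem_nhds hz
    have hr := ((hi.mul hR).congr_of_eventuallyEq (hev.mono fun w hw => (ih w hw).1)).deriv
    have hs := (((hi.mul hS).sub (hR.const_mul (μ : ℂ))).congr_of_eventuallyEq
      (hev.mono fun w hw => (ih w hw).2)).deriv
    simp only [rsSeq]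
    rw [hr, hs, (ih z hz).1, (ih z hz).2]
    have e2 : ((2 : ℝ[X])) = C 2 := (map_ofNat C 2).symm
    constructor
    · simp only [rsPoly, pairD, Prod.fst_add, Prod.fst_neg, Prod.smul_fst, smul_eq_mul, map_add,
        map_sub, map_mul, map_pow, aeval_X, aeval_C, map_neg, e2,
        map_one, map_natCast, Complex.coe_algebraMap, id, Pi.pow_apply]
      push_cast
      field_simp
      ring
    · simp only [rsPoly, pairD, Prod.fst_add, Prod.fst_neg, Prod.smul_fst, smul_eq_mul, map_add,
        Prod.snd_add, Prod.snd_neg, Prod.smul_snd,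
        map_sub, map_mul, map_pow, aeval_X, aeval_C, map_neg, e2,
        map_one, map_natCast, Complex.coe_algebraMap, id, Pi.pow_apply]
      rw [hl]
      push_cast
      have hωc : (ω : ℂ) ≠ 0 := by exact_mod_cast hω
      field_simp
      ring

/-! ### The Laurent polynomials of the intertwining matrix -/

/-- `z^{-ℓ} (𝔮 + μ z² 𝔭)`. -/
noncomputable def alpha (ω μ : ℝ) (l : ℕ) (z : ℂ) : ℂ :=
  (z ^ l)⁻¹ * aeval z (pqPoly ω μ l l).2

/-- `z^{1-ℓ} 𝔭`. -/
noncomputable def beta (ω μ : ℝ) (l : ℕ) (z : ℂ) : ℂ :=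
  z * (z ^ l)⁻¹ * aeval z (pqPoly ω μ l l).1

/-- The second component of `pairD_pqPoly_diag`, with `rsPoly` rewritten by reversal as a value at
1/z. `hasDerivAt_beta` comes from the first component. -/
theorem hasDerivAt_alpha (hω : ω ≠ 0) {z : ℂ} (hz : z ≠ 0) :
    HasDerivAt (alpha ω μ l) (z⁻¹ * (-(l * alpha ω μ l z)
      + ((2 * (ω : ℂ)) ^ 2)⁻¹ * (beta ω μ l z + (-1) ^ l * beta ω μ l z⁻¹))) z := by
  have hQ : HasDerivAt (fun z => aeval z (pqPoly ω μ l l).2)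
      (aeval z (derivative (pqPoly ω μ l l).2)) z := Polynomial.hasDerivAt_aeval _ z
  have hi : HasDerivAt (fun z : ℂ => (z ^ l)⁻¹) _ z :=
    ((hasDerivAt_id z).pow l).inv (by simpa using pow_ne_zero l hz)
  refine (hi.mul hQ).congr_deriv ?_
  have h := congrArg (fun v => aeval z v.2) (pairD_pqPoly_diag (ω := ω) (μ := μ) (l := l))
  simp only [pairD, Prod.snd_add, Prod.smul_snd, smul_eq_mul, map_add, map_sub, map_mul, map_pow,
    aeval_X, aeval_C, map_neg, map_one, Complex.coe_algebraMap, aeval_rsPoly_snd hω hz] at h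
  have hz2 : z * z⁻¹ = 1 := mul_inv_cancel₀ hz
  have hd : aeval z (derivative (pqPoly ω μ l l).2) = (z ^ 2)⁻¹ *
      (((2 * (ω : ℂ)) ^ 2)⁻¹ * (z ^ 2 * aeval z (pqPoly ω μ l l).1
        + (-1) ^ l * z ^ (2 * l) * aeval z⁻¹ (pqPoly ω μ l l).1)) := by
    rw [eq_inv_mul_iff_mul_eq₀ (pow_ne_zero 2 hz)]
    push_cast at h ⊢
    linear_combination h
  have hl : (l : ℂ) * z ^ (l - 1) = l * z ^ l * z⁻¹ := by
    cases l with
    | zero => simp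
    | succ n => rw [Nat.add_sub_cancel, pow_succ]; field_simp
  rw [hd]
  simp only [alpha, beta, id, mul_one, Pi.pow_apply, hl, inv_pow, inv_inv]
  have hzl : z ^ l ≠ 0 := pow_ne_zero l hz
  rw [mul_comm 2 l, pow_mul]
  field_simp

theorem hasDerivAt_beta {z : ℂ} (hz : z ≠ 0) :
    HasDerivAt (beta ω μ l) (z⁻¹ * (μ * (z + z⁻¹) * beta ω μ l z
      - alpha ω μ l z + (-1) ^ l * alpha ω μ l z⁻¹)) z := by
  have hP : HasDerivAt (fun z => aeval z (pqPoly ω μ l l).1)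
      (aeval z (derivative (pqPoly ω μ l l).1)) z := Polynomial.hasDerivAt_aeval _ z
  have hi : HasDerivAt (fun z : ℂ => (z ^ l)⁻¹) _ z :=
    ((hasDerivAt_id z).pow l).inv (by simpa using pow_ne_zero l hz)
  refine (((hasDerivAt_id z).mul hi).mul hP).congr_deriv ?_
  have h := congrArg (fun v => aeval z v.1) (pairD_pqPoly_diag (ω := ω) (μ := μ) (l := l))
  simp only [pairD, Prod.fst_add, Prod.smul_fst, smul_eq_mul, map_add, map_sub, map_mul, map_pow,
    aeval_X, aeval_C, map_neg, map_one, map_natCast, Complex.coe_algebraMap,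
    aeval_rsPoly_fst hz] at h
  have hd : aeval z (derivative (pqPoly ω μ l l).1) = (z ^ 2)⁻¹ *
      ((μ * z ^ 2 + μ + (l - 1) * z) * aeval z (pqPoly ω μ l l).1 - aeval z (pqPoly ω μ l l).2
        + (-1) ^ l * z ^ (2 * l) * aeval z⁻¹ (pqPoly ω μ l l).2) := by
    rw [eq_inv_mul_iff_mul_eq₀ (pow_ne_zero 2 hz)]
    linear_combination h
  have hl : (l : ℂ) * z ^ (l - 1) = l * z ^ l * z⁻¹ := by
    cases l with
    | zero => simp
    | succ n => rw [Nat.add_sub_cancel, pow_succ]; field_simp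
  rw [hd]
  simp only [alpha, beta, id, mul_one, one_mul, Pi.pow_apply, Pi.mul_apply, hl, inv_pow, inv_inv]
  have hzl : z ^ l ≠ 0 := pow_ne_zero l hz
  rw [mul_comm 2 l, pow_mul]
  field_simp
  ring

/-- The odd coefficients of 𝔮 + μz²𝔭 vanish, so only the prefactor z^{-ℓ} contributes a sign. This
is needed because the half-period shift brings in the point -1. -/
theorem alpha_neg_one (hω : ω ≠ 0) : alpha ω μ l (-1) = (-1) ^ l * alpha ω μ l 1 := by
  have h : aeval (-1 : ℂ) (pqPoly ω μ l l).2 = aeval (1 : ℂ) (pqPoly ω μ l l).2 := by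
    rw [aeval_eq_sum_range, aeval_eq_sum_range]
    refine Finset.sum_congr rfl fun i _ => ?_
    rcases Nat.even_or_odd i with hi | hi
    · simp [hi.neg_one_pow]
    · rw [← coeffZ_natCast, coeffZ_diag_snd_odd hω (by exact_mod_cast hi)]; simp
  simp only [alpha, h]
  rcases neg_one_pow_eq_or ℂ l with hl | hl <;> simp [hl]

theorem beta_neg_one (hω : ω ≠ 0) (hl : 0 < l) : beta ω μ l (-1) = beta ω μ l 1 := by
  -- The symmetry sends indices above 2ℓ - 2 to negative ones.
  have hdeg : (pqPoly ω μ l l).1.natDegree ≤ 2 * (l - 1) := natDegree_le_of_coeffZ fun n hn => by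
    rw [coeffZ_diag_fst_symm hω, coeffZ_of_neg _ (by omega), mul_zero]
  have h : aeval (-1 : ℂ) (pqPoly ω μ l l).1
      = (-1) ^ (l + 1) * aeval (1 : ℂ) (pqPoly ω μ l l).1 := by
    rw [aeval_eq_sum_range' (Nat.lt_succ_of_le hdeg), aeval_eq_sum_range' (Nat.lt_succ_of_le hdeg),
      ← Finset.sum_range_reflect, Finset.mul_sum]
    refine Finset.sum_congr rfl fun i hi => ?_
    have hi : i ≤ 2 * (l - 1) := by simpa [Nat.lt_succ_iff] using hi
    rw [show (2 * (l - 1)).succ - 1 - i = 2 * (l - 1) - i by omega, ← coeffZ_natCast,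
      coeffZ_diag_fst_symm hω,
      show 2 * (l : ℤ) - 2 - ((2 * (l - 1) - i : ℕ) : ℤ) = (i : ℤ) by omega, coeffZ_natCast,
      zpow_natCast]
    have e : ((-1 : ℂ)) ^ (2 * (l - 1) - i) * (-1) ^ (2 * (l - 1) - i) = 1 := by
      rw [← mul_pow]; simp
    simp only [Complex.real_smul, one_pow]
    push_cast
    linear_combination ((-1) ^ (l + 1) * ((pqPoly ω μ l l).1.coeff i : ℂ)) * e
  simp only [beta, h, pow_succ]
  rcases neg_one_pow_eq_or ℂ l with hl | hl <;> simp [hl]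

theorem alpha_one_eq_ofReal : alpha ω μ l 1 = (((pqPoly ω μ l l).2.eval 1 : ℝ) : ℂ) := by
  have := aeval_algebraMap_apply ℂ (1 : ℝ) (pqPoly ω μ l l).2
  simp only [map_one] at this
  simp [alpha, this, Polynomial.aeval_def]

theorem beta_one_eq_ofReal : beta ω μ l 1 = (((pqPoly ω μ l l).1.eval 1 : ℝ) : ℂ) := by
  have := aeval_algebraMap_apply ℂ (1 : ℝ) (pqPoly ω μ l l).1
  simp only [map_one] at this
  simp [beta, this, Polynomial.aeval_def]

theorem polyP_one : polyP ω μ l 1 = beta ω μ l 1 := by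
  simp [polyP, beta, (pqSeq_eq (ω := ω) (μ := μ) (l := l) l).1]

theorem polyR_one (hω : ω ≠ 0) : polyR ω μ l 1 = alpha ω μ l 1 := by
  simp [polyR, alpha, (rsSeq_eq (ω := ω) (μ := μ) (l := l) hω l 1 one_ne_zero).1,
    aeval_rsPoly_fst (ω := ω) (μ := μ) (l := l) (k := l) one_ne_zero]

end

section

variable {ω μ : ℝ} {l : ℕ}

/-! ### Auxiliary facts on functions of a real variable -/

theorem eq_of_hasDerivAt_zero {f : ℝ → ℂ} {a b : ℝ} (hab : a ≤ b) (hc : ContinuousOn f (Icc a b))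
    (hd : ∀ t ∈ Ioo a b, HasDerivAt f 0 t) : f a = f b := by
  rcases eq_or_lt_of_le hab with rfl | hab
  · rfl
  apply Complex.ext
  · obtain ⟨c, _, h⟩ := exists_hasDerivAt_eq_slope (fun t => (f t).re) (fun _ => 0) hab
      (Complex.continuous_re.comp_continuousOn hc)
      (fun t ht => (Complex.reCLM.hasFDerivAt.comp_hasDerivAt t (hd t ht)).congr_deriv (by simp))
    rcases div_eq_zero_iff.mp h.symm with h | h <;> linarith
  · obtain ⟨c, _, h⟩ := exists_hasDerivAt_eq_slope (fun t => (f t).im) (fun _ => 0) hab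
      (Complex.continuous_im.comp_continuousOn hc)
      (fun t ht => (Complex.imCLM.hasFDerivAt.comp_hasDerivAt t (hd t ht)).congr_deriv (by simp))
    rcases div_eq_zero_iff.mp h.symm with h | h <;> linarith

/-- A Grönwall argument. Only boundedness of k on the open interval is asked, so an endpoint where
the equation itself is not available may serve as initial point. -/
theorem eq_zero_of_linear_of_left {d k : ℝ → ℂ} {a b M : ℝ} (hc : ContinuousOn d (Icc a b))
    (hd : ∀ t ∈ Ioo a b, HasDerivAt d (k t * d t) t) (hk : ∀ t ∈ Ioo a b, ‖k t‖ ≤ M)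
    (ha : d a = 0) {t : ℝ} (ht : t ∈ Icc a b) : d t = 0 := by
  -- The derivative of |d|² is at most 2M|d|², so this weight makes g nonincreasing.
  set g : ℝ → ℝ := fun t => ‖d t‖ ^ 2 * Real.exp (-(2 * M * t)) with hg
  have hgd : ∀ t ∈ Ioo a b, HasDerivAt g (2 * inner ℝ (d t) (k t * d t) * Real.exp (-(2 * M * t))
      + ‖d t‖ ^ 2 * (Real.exp (-(2 * M * t)) * -(2 * M))) t := fun t ht => by
    have h2 : HasDerivAt (fun t : ℝ => -(2 * M * t)) (-(2 * M)) t :=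
      ((hasDerivAt_id t).const_mul (2 * M)).neg.congr_deriv (by simp)
    exact (hd t ht).norm_sq.mul h2.exp
  have hanti : AntitoneOn g (Icc a b) := by
    apply antitoneOn_of_deriv_nonpos (convex_Icc a b)
    · exact (hc.norm.pow 2).mul (by fun_prop)
    · rw [interior_Icc]
      exact fun t ht => (hgd t ht).differentiableAt.differentiableWithinAt
    · rw [interior_Icc]
      intro t ht
      rw [(hgd t ht).deriv]
      have h1 : inner ℝ (d t) (k t * d t) ≤ M * ‖d t‖ ^ 2 := by
        refine (real_inner_le_norm _ _).trans ?_
        rw [norm_mul]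
        nlinarith [hk t ht, norm_nonneg (d t), sq_nonneg ‖d t‖]
      have h3 := Real.exp_pos (-(2 * M * t))
      nlinarith
  have h0 := hanti (left_mem_Icc.mpr (ht.1.trans ht.2)) ht ht.1
  have hga : g a = 0 := by simp [hg, ha]
  rw [hga] at h0
  have h3 := Real.exp_pos (-(2 * M * t))
  have h4 : ‖d t‖ ^ 2 ≤ 0 := by
    by_contra hneg
    exact absurd h0 (not_le.mpr (mul_pos (not_le.mp hneg) h3))
  have h5 : ‖d t‖ = 0 := by nlinarith [norm_nonneg (d t)]
  exact norm_eq_zero.mp h5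

theorem eq_zero_of_linear_of_right {d k : ℝ → ℂ} {a b M : ℝ} (hc : ContinuousOn d (Icc a b))
    (hd : ∀ t ∈ Ioo a b, HasDerivAt d (k t * d t) t) (hk : ∀ t ∈ Ioo a b, ‖k t‖ ≤ M)
    (hb : d b = 0) {t : ℝ} (ht : t ∈ Icc a b) : d t = 0 := by
  have hm : ∀ s ∈ Ioo (-b) (-a), -s ∈ Ioo a b := fun s hs => ⟨by linarith [hs.2], by linarith [hs.1]⟩
  have h := eq_zero_of_linear_of_left (d := fun s => d (-s)) (k := fun s => -k (-s)) (a := -b)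
    (b := -a) (M := M) (t := -t)
    (hc.comp continuousOn_neg fun s hs => ⟨by linarith [hs.2], by linarith [hs.1]⟩)
    (fun s hs => by
      have := (hd (-s) (hm s hs)).scomp s (hasDerivAt_neg s)
      simpa [Function.comp_def] using this)
    (fun s hs => by simpa using hk (-s) (hm s hs)) (by simpa using hb)
    ⟨by linarith [ht.2], by linarith [ht.1]⟩
  simpa using h

/-- A solution of a homogeneous linear equation with continuous coefficient vanishes identically
if it vanishes at one point of an open interval. -/
theorem eq_zero_of_linear {d k : ℝ → ℂ} {a b s : ℝ} (hs : s ∈ Ioo a b)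
    (hd : ∀ t ∈ Ioo a b, HasDerivAt d (k t * d t) t) (hk : ContinuousOn k (Ioo a b))
    (h0 : d s = 0) {t : ℝ} (ht : t ∈ Ioo a b) : d t = 0 := by
  have hcont : ContinuousOn d (Ioo a b) := fun t ht => (hd t ht).continuousAt.continuousWithinAt
  rcases le_total s t with hst | hst
  · have hsub : Icc s t ⊆ Ioo a b := fun u hu => ⟨hs.1.trans_le hu.1, hu.2.trans_lt ht.2⟩
    obtain ⟨M, hM⟩ := isCompact_Icc.exists_bound_of_continuousOn (hk.mono hsub)
    exact eq_zero_of_linear_of_left (hcont.mono hsub)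
      (fun u hu => hd u (hsub (Ioo_subset_Icc_self hu)))
      (fun u hu => hM u (Ioo_subset_Icc_self hu)) h0 (right_mem_Icc.mpr hst)
  · have hsub : Icc t s ⊆ Ioo a b := fun u hu => ⟨ht.1.trans_le hu.1, hu.2.trans_lt hs.2⟩
    obtain ⟨M, hM⟩ := isCompact_Icc.exists_bound_of_continuousOn (hk.mono hsub)
    exact eq_zero_of_linear_of_right (hcont.mono hsub)
      (fun u hu => hd u (hsub (Ioo_subset_Icc_self hu)))
      (fun u hu => hM u (Ioo_subset_Icc_self hu)) h0 (left_mem_Icc.mpr hst)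

/-! ### The punctured circle -/

theorem half_period (ω : ℝ) : period ω / 2 = Real.pi / ω := by unfold period; ring

theorem half_period_pos (hω : 0 < ω) : 0 < period ω / 2 := by
  rw [half_period]; exact div_pos Real.pi_pos hω

theorem circlePoint_zero : circlePoint ω 0 = 1 := by simp [circlePoint]

theorem circlePoint_ne_zero (t : ℝ) : circlePoint ω t ≠ 0 := Complex.exp_ne_zero _

theorem circlePoint_neg (t : ℝ) : circlePoint ω (-t) = (circlePoint ω t)⁻¹ := by
  rw [circlePoint, circlePoint, ← Complex.exp_neg]; congr 1; push_cast; ring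

theorem circlePoint_half_period (hω : ω ≠ 0) : circlePoint ω (period ω / 2) = -1 := by
  have : (ω : ℂ) ≠ 0 := by exact_mod_cast hω
  rw [half_period, circlePoint, ← Complex.exp_pi_mul_I]
  congr 1; push_cast; field_simp

theorem hasDerivAt_circlePoint (t : ℝ) :
    HasDerivAt (circlePoint ω) (Complex.I * ω * circlePoint ω t) t := by
  have h : HasDerivAt (fun t : ℝ => Complex.I * (ω : ℂ) * (t : ℂ)) (Complex.I * ω) t := by
    simpa using (Complex.ofRealCLM.hasDerivAt (x := t)).const_mul (Complex.I * (ω : ℂ))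
  exact h.cexp.congr_deriv (by rw [circlePoint]; ring)

theorem norm_circlePoint (t : ℝ) : ‖circlePoint ω t‖ = 1 := by
  rw [circlePoint, show Complex.I * (ω : ℂ) * t = ((ω * t : ℝ) : ℂ) * Complex.I by push_cast; ring]
  exact Complex.norm_exp_ofReal_mul_I _

theorem circlePoint_add_neg (t : ℝ) :
    circlePoint ω t + circlePoint ω (-t) = 2 * (Real.cos (ω * t) : ℂ) := by
  rw [Complex.ofReal_cos, Complex.cos, circlePoint, circlePoint]
  push_cast
  rw [show Complex.I * (ω : ℂ) * t = ω * t * Complex.I by ring,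
    show Complex.I * (ω : ℂ) * -t = -(ω * t) * Complex.I by ring]
  ring

theorem arg_circlePoint (hω : 0 < ω) {t : ℝ} (ht : t ∈ Ioo (-(period ω / 2)) (period ω / 2)) :
    (circlePoint ω t).arg = ω * t := by
  rw [half_period] at ht
  have h1 : ω * (Real.pi / ω) = Real.pi := by field_simp
  rw [circlePoint, show Complex.I * (ω : ℂ) * t = ((ω * t : ℝ) : ℂ) * Complex.I by push_cast; ring,
    Complex.arg_exp_mul_I, toIocMod_eq_self]
  constructor
  · nlinarith [ht.1]
  · nlinarith [ht.2]

theorem circlePoint_mem (hω : 0 < ω) {t : ℝ} (ht : t ∈ Ioo (-(period ω / 2)) (period ω / 2)) :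
    circlePoint ω t ∈ puncturedCircle := by
  refine ⟨norm_circlePoint t, fun h => ?_⟩
  have h1 := arg_circlePoint hω ht
  rw [h, Complex.arg_neg_one, ← mul_div_cancel₀ Real.pi hω.ne'] at h1
  have := ht.2
  rw [half_period] at this
  have h2 : ω * (Real.pi / ω) = Real.pi := by field_simp
  nlinarith [mul_div_cancel₀ Real.pi hω.ne']

theorem exists_circlePoint (hω : 0 < ω) {z : ℂ} (hz : z ∈ puncturedCircle) :
    z.arg / ω ∈ Ioo (-(period ω / 2)) (period ω / 2) ∧ circlePoint ω (z.arg / ω) = z := by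
  have hωc : (ω : ℂ) ≠ 0 := by exact_mod_cast hω.ne'
  have harg : z.arg ≠ Real.pi := by
    intro h
    apply hz.2
    have := Complex.norm_mul_exp_arg_mul_I z
    rw [hz.1, h, Complex.exp_pi_mul_I] at this
    simpa using this.symm
  refine ⟨?_, ?_⟩
  · rw [half_period, ← neg_div]
    exact ⟨div_lt_div_of_pos_right (Complex.neg_pi_lt_arg z) hω,
      div_lt_div_of_pos_right (lt_of_le_of_ne (Complex.arg_le_pi z) harg) hω⟩
  · have := Complex.norm_mul_exp_arg_mul_I z
    rw [hz.1] at this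
    rw [circlePoint]
    refine Eq.trans ?_ this
    simp only [Complex.ofReal_one, one_mul]
    congr 1; push_cast; field_simp

theorem eventually_puncturedCircle (hω : 0 < ω) {p : ℂ → Prop} :
    (∀ᶠ z in 𝓝ˢ puncturedCircle, p z) ↔
      ∀ t ∈ Ioo (-(period ω / 2)) (period ω / 2), ∀ᶠ z in 𝓝 (circlePoint ω t), p z := by
  rw [eventually_nhdsSet_iff_forall]
  refine ⟨fun h t ht => h _ (circlePoint_mem hω ht), fun h z hz => ?_⟩
  obtain ⟨h1, h2⟩ := exists_circlePoint hω hz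
  rw [← h2]; exact h _ h1

theorem zero_mem_half (hω : 0 < ω) : (0 : ℝ) ∈ Ioo (-(period ω / 2)) (period ω / 2) :=
  ⟨by linarith [half_period_pos hω], half_period_pos hω⟩

theorem neg_mem_half {t : ℝ} (ht : t ∈ Ioo (-(period ω / 2)) (period ω / 2)) :
    -t ∈ Ioo (-(period ω / 2)) (period ω / 2) := ⟨by linarith [ht.2], by linarith [ht.1]⟩

theorem eventually_inv_puncturedCircle (hω : 0 < ω) {p : ℂ → Prop}
    (h : ∀ᶠ z in 𝓝ˢ puncturedCircle, p z) : ∀ᶠ z in 𝓝ˢ puncturedCircle, p z⁻¹ := by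
  rw [eventually_puncturedCircle hω] at h ⊢
  intro t ht
  have h1 := h (-t) (neg_mem_half ht)
  rw [circlePoint_neg] at h1
  exact (tendsto_inv₀ (circlePoint_ne_zero t)).eventually h1

theorem eventually_ne_zero_puncturedCircle : ∀ᶠ z in 𝓝ˢ puncturedCircle, z ≠ (0 : ℂ) := by
  rw [eventually_nhdsSet_iff_forall]
  intro z hz
  apply isOpen_ne.mem_nhds
  rintro rfl
  simp [puncturedCircle] at hz

/-- The identity theorem on the punctured circle. -/
theorem eventually_eq_of_eq_on_circle (hω : 0 < ω) {f g : ℂ → ℂ}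
    (hf : ∀ᶠ z in 𝓝ˢ puncturedCircle, AnalyticAt ℂ f z)
    (hg : ∀ᶠ z in 𝓝ˢ puncturedCircle, AnalyticAt ℂ g z)
    (h : ∀ t ∈ Ioo (-(period ω / 2)) (period ω / 2), f (circlePoint ω t) = g (circlePoint ω t)) :
    ∀ᶠ z in 𝓝ˢ puncturedCircle, f z = g z := by
  rw [eventually_puncturedCircle hω] at hf hg ⊢
  intro t ht
  refine ((hf t ht).self_of_nhds.frequently_eq_iff_eventually_eq (hg t ht).self_of_nhds).mp ?_
  have hne : Complex.I * (ω : ℂ) * circlePoint ω t ≠ 0 :=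
    mul_ne_zero (mul_ne_zero Complex.I_ne_zero (by exact_mod_cast hω.ne')) (circlePoint_ne_zero t)
  have htend := (hasDerivAt_circlePoint (ω := ω) t).tendsto_nhdsNE hne
  apply htend.frequently
  apply Eventually.frequently
  apply eventually_nhdsWithin_of_eventually_nhds
  filter_upwards [Ioo_mem_nhds ht.1 ht.2] with s hs using h s hs

/-! ### The linear system on the circle -/

/-- The phase velocity `ω (ℓ + 2 μ cos ωt)`. -/
noncomputable def drive (ω μ : ℝ) (l : ℕ) (t : ℝ) : ℂ :=
  (ω : ℂ) * ((l : ℂ) + 2 * (μ : ℂ) * (Real.cos (ω * t) : ℂ))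

/-- `(u, v)` solves the linear system on `(a, b)` and is continuous on `[a, b]`. -/
structure IsSys (ω μ : ℝ) (l : ℕ) (a b : ℝ) (u v : ℝ → ℂ) : Prop where
  cont_fst : ContinuousOn u (Icc a b)
  cont_snd : ContinuousOn v (Icc a b)
  deriv_fst : ∀ t ∈ Ioo a b,
    HasDerivAt u (1 / 2 * v t + Complex.I * drive ω μ l t / 2 * u t) t
  deriv_snd : ∀ t ∈ Ioo a b,
    HasDerivAt v (1 / 2 * u t - Complex.I * drive ω μ l t / 2 * v t) t

theorem drive_neg (t : ℝ) : drive ω μ l (-t) = drive ω μ l t := by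
  simp [drive]

theorem drive_add_half_period (hω : ω ≠ 0) (t : ℝ) :
    drive ω μ l (t + period ω / 2)
      = (ω : ℂ) * ((l : ℂ) - 2 * (μ : ℂ) * (Real.cos (ω * t) : ℂ)) := by
  rw [drive, half_period, show ω * (t + Real.pi / ω) = ω * t + Real.pi by field_simp,
    Real.cos_add_pi]
  push_cast; ring

theorem IsSys.mono {a b a' b' : ℝ} {u v : ℝ → ℂ} (h : IsSys ω μ l a b u v) (ha : a ≤ a')
    (hb : b' ≤ b) : IsSys ω μ l a' b' u v :=
  ⟨h.cont_fst.mono (Icc_subset_Icc ha hb), h.cont_snd.mono (Icc_subset_Icc ha hb),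
    fun t ht => h.deriv_fst t (Ioo_subset_Ioo ha hb ht),
    fun t ht => h.deriv_snd t (Ioo_subset_Ioo ha hb ht)⟩

/-- The coefficient matrix has trace zero. -/
theorem IsSys.wronskian {a b : ℝ} {u v u' v' : ℝ → ℂ} (hab : a ≤ b) (h : IsSys ω μ l a b u v)
    (h' : IsSys ω μ l a b u' v') : u a * v' a - v a * u' a = u b * v' b - v b * u' b := by
  refine eq_of_hasDerivAt_zero (f := fun t => u t * v' t - v t * u' t) hab
    ((h.cont_fst.mul h'.cont_snd).sub (h.cont_snd.mul h'.cont_fst)) fun t ht => ?_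
  refine (((h.deriv_fst t ht).mul (h'.deriv_snd t ht)).sub
    ((h.deriv_snd t ht).mul (h'.deriv_fst t ht))).congr_deriv ?_
  ring

/-- `drive` is even in t; swapping the components with one sign change absorbs the reversal of time.
-/
theorem IsSys.reflect {a : ℝ} {u v : ℝ → ℂ} (h : IsSys ω μ l (-a) a u v) :
    IsSys ω μ l (-a) a (fun t => v (-t)) (fun t => -u (-t)) := by
  have hm : ∀ s ∈ Ioo (-a) a, -s ∈ Ioo (-a) a := fun s hs => ⟨by linarith [hs.2], by linarith [hs.1]⟩
  have hm' : MapsTo (fun s : ℝ => -s) (Icc (-a) a) (Icc (-a) a) :=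
    fun s hs => ⟨by linarith [hs.2], by linarith [hs.1]⟩
  refine ⟨h.cont_snd.comp continuousOn_neg hm', (h.cont_fst.comp continuousOn_neg hm').neg,
    fun t ht => ?_, fun t ht => ?_⟩
  · have := (h.deriv_snd (-t) (hm t ht)).scomp t (hasDerivAt_neg t)
    refine this.congr_deriv ?_
    rw [drive_neg]; simp; ring
  · have := ((h.deriv_fst (-t) (hm t ht)).scomp t (hasDerivAt_neg t)).neg
    refine this.congr_deriv ?_
    rw [drive_neg]; simp; ring

theorem hasDerivAt_alpha_circlePoint (hω : ω ≠ 0) (s : ℝ) :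
    HasDerivAt (fun s => alpha ω μ l (circlePoint ω s)) (Complex.I * ω *
      (-(l * alpha ω μ l (circlePoint ω s)) + ((2 * (ω : ℂ)) ^ 2)⁻¹ *
        (beta ω μ l (circlePoint ω s) + (-1) ^ l * beta ω μ l (circlePoint ω (-s))))) s := by
  have h0 := circlePoint_ne_zero (ω := ω) s
  refine ((hasDerivAt_alpha hω h0).comp_of_eq s (hasDerivAt_circlePoint s) rfl).congr_deriv ?_
  rw [circlePoint_neg]
  field_simp

theorem hasDerivAt_beta_circlePoint (s : ℝ) :
    HasDerivAt (fun s => beta ω μ l (circlePoint ω s)) (Complex.I * ω *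
      (2 * μ * (Real.cos (ω * s) : ℂ) * beta ω μ l (circlePoint ω s)
        - alpha ω μ l (circlePoint ω s) + (-1) ^ l * alpha ω μ l (circlePoint ω (-s)))) s := by
  have h0 := circlePoint_ne_zero (ω := ω) s
  refine ((hasDerivAt_beta h0).comp_of_eq s (hasDerivAt_circlePoint s) rfl).congr_deriv ?_
  have := circlePoint_add_neg (ω := ω) s
  rw [circlePoint_neg] at this ⊢
  rw [this]
  field_simp

/-- The half-period shift of a solution, corrected by the intertwining matrix, is a solution. -/
theorem IsSys.halfShift (hω : 0 < ω) {x y : ℝ → ℂ}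
    (h : IsSys ω μ l (-(period ω / 2)) (period ω / 2) x y) :
    IsSys ω μ l (-(period ω / 2)) 0
      (fun t => (-1) ^ (l + 1) *
        (Complex.I * beta ω μ l (circlePoint ω (-(t + period ω / 2))) / (2 * ω) * x (t + period ω / 2)
          + alpha ω μ l (circlePoint ω (-(t + period ω / 2))) * y (t + period ω / 2)))
      (fun t => -(alpha ω μ l (circlePoint ω (t + period ω / 2)) * x (t + period ω / 2))
        + Complex.I * beta ω μ l (circlePoint ω (t + period ω / 2)) / (2 * ω)
          * y (t + period ω / 2)) := by
  have hωc : (ω : ℂ) ≠ 0 := by exact_mod_cast hω.ne'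
  have hsq : ((-1 : ℂ)) ^ l * (-1) ^ l = 1 := by rw [← mul_pow]; simp
  have hτ := half_period_pos hω
  set τ := period ω / 2 with hτdef
  have hI := Complex.I_mul_I
  have ha : ∀ s, HasDerivAt (fun t => alpha ω μ l (circlePoint ω (t + τ))) _ s := fun s =>
    (hasDerivAt_alpha_circlePoint (μ := μ) (l := l) hω.ne' (s + τ)).comp_add_const s τ
  have hb : ∀ s, HasDerivAt (fun t => beta ω μ l (circlePoint ω (t + τ))) _ s := fun s =>
    (hasDerivAt_beta_circlePoint (μ := μ) (l := l) (s + τ)).comp_add_const s τ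
  have hnegd : ∀ s : ℝ, HasDerivAt (fun t => -(t + τ)) (-1) s := fun s =>
    ((hasDerivAt_id s).add_const τ).neg
  have ha' := fun s =>
    (hasDerivAt_alpha_circlePoint (μ := μ) (l := l) hω.ne' (-(s + τ))).scomp s (hnegd s)
  have hb' := fun s =>
    (hasDerivAt_beta_circlePoint (ω := ω) (μ := μ) (l := l) (-(s + τ))).scomp s (hnegd s)
  simp only [Function.comp_def] at ha' hb'
  have hmI : MapsTo (fun t : ℝ => t + τ) (Icc (-τ) 0) (Icc (-τ) τ) :=
    fun t ht => ⟨by linarith [ht.1], by linarith [ht.2]⟩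
  have hmo : ∀ t ∈ Ioo (-τ) 0, t + τ ∈ Ioo (-τ) τ := fun t ht =>
    ⟨by linarith [ht.1], by linarith [ht.2]⟩
  have hxc : ContinuousOn (fun t => x (t + τ)) (Icc (-τ) 0) :=
    h.cont_fst.comp (by fun_prop) hmI
  have hyc : ContinuousOn (fun t => y (t + τ)) (Icc (-τ) 0) :=
    h.cont_snd.comp (by fun_prop) hmI
  have hcont : ∀ {f : ℝ → ℂ} {f' : ℝ → ℂ}, (∀ s, HasDerivAt f (f' s) s) →
      ContinuousOn f (Icc (-τ) 0) := fun hf t _ => (hf t).continuousAt.continuousWithinAt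
  -- Half a period flips the cosine. The resulting sign change of the μ-term is exactly what the
  -- derivatives of `alpha` and `beta` compensate.
  have hcos : ∀ t, (Real.cos (ω * (t + τ)) : ℂ) = -(Real.cos (ω * t) : ℂ) := fun t => by
    rw [hτdef, half_period, show ω * (t + Real.pi / ω) = ω * t + Real.pi by field_simp,
      Real.cos_add_pi]; push_cast; ring
  refine ⟨?_, ?_, fun t ht => ?_, fun t ht => ?_⟩
  · exact continuousOn_const.mul ((((continuousOn_const.mul (hcont hb')).div_const _).mul hxc).add
      ((hcont ha').mul hyc))
  · exact ((hcont ha).mul hxc).neg.add (((continuousOn_const.mul (hcont hb)).div_const _).mul hyc)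
  · have hx := (h.deriv_fst (t + τ) (hmo t ht)).comp_add_const t τ
    have hy := (h.deriv_snd (t + τ) (hmo t ht)).comp_add_const t τ
    refine (((((hb' t).const_mul Complex.I).div_const (2 * (ω : ℂ))).mul hx).add
      ((ha' t).mul hy) |>.const_mul ((-1 : ℂ) ^ (l + 1))).congr_deriv ?_
    rw [drive_add_half_period hω.ne', drive, neg_neg, mul_neg, Real.cos_neg, hcos]
    generalize (Real.cos (ω * t) : ℂ) = c
    generalize alpha ω μ l (circlePoint ω (t + τ)) = a1
    generalize alpha ω μ l (circlePoint ω (-(t + τ))) = a2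
    generalize beta ω μ l (circlePoint ω (t + τ)) = b1
    generalize beta ω μ l (circlePoint ω (-(t + τ))) = b2
    generalize x (t + τ) = x0
    generalize y (t + τ) = y0
    simp only [Complex.real_smul]
    push_cast
    rw [pow_succ (-1 : ℂ) l]
    generalize (-1 : ℂ) ^ l = e at hsq ⊢
    field_simp
    linear_combination (-2 * e * ω * a2 * x0 + 2 * ω * a1 * x0) * hI
      + (Complex.I * y0 * b1 + 2 * ω * a1 * x0 * Complex.I ^ 2) * hsq
  · have hx := (h.deriv_fst (t + τ) (hmo t ht)).comp_add_const t τ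
    have hy := (h.deriv_snd (t + τ) (hmo t ht)).comp_add_const t τ
    refine (((ha t).mul hx).neg.add
      ((((hb t).const_mul Complex.I).div_const (2 * (ω : ℂ))).mul hy)).congr_deriv ?_
    rw [drive_add_half_period hω.ne', drive, hcos]
    generalize (Real.cos (ω * t) : ℂ) = c
    generalize alpha ω μ l (circlePoint ω (t + τ)) = a1
    generalize alpha ω μ l (circlePoint ω (-(t + τ))) = a2
    generalize beta ω μ l (circlePoint ω (t + τ)) = b1
    generalize beta ω μ l (circlePoint ω (-(t + τ))) = b2
    generalize x (t + τ) = x0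
    generalize y (t + τ) = y0
    rw [pow_succ (-1 : ℂ) l]
    generalize (-1 : ℂ) ^ l = e at hsq ⊢
    field_simp
    linear_combination (-2 * ω * a1 * y0 + 2 * ω * e * y0 * a2) * hI

/-- The relations between the values of a solution at `0` and `±T/2` implied by the intertwining
matrix. -/
theorem IsSys.endpoint_relations (hω : 0 < ω) (hl : 0 < l) {x y : ℝ → ℂ}
    (h : IsSys ω μ l (-(period ω / 2)) (period ω / 2) x y) {a b ε : ℂ}
    (ha : a = alpha ω μ l 1) (hb : b = beta ω μ l 1 / (2 * ω)) (hε : ε = (-1) ^ (l + 1)) :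
    x 0 * (ε * a * x (period ω / 2) + Complex.I * b * y (period ω / 2))
        - y 0 * (ε * Complex.I * b * x (period ω / 2) - a * y (period ω / 2))
      = x (-(period ω / 2)) * (-a * x 0 + Complex.I * b * y 0)
        - y (-(period ω / 2)) * (ε * Complex.I * b * x 0 + ε * a * y 0) ∧
    (ε * Complex.I * b * x (period ω / 2) - a * y (period ω / 2)) * x 0
        + (ε * a * x (period ω / 2) + Complex.I * b * y (period ω / 2)) * y 0
      = (ε * Complex.I * b * x 0 + ε * a * y 0) * x (period ω / 2)
        + (-a * x 0 + Complex.I * b * y 0) * y (period ω / 2) := by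
  have hτ := half_period_pos hω
  have hs := h.halfShift hω
  -- The shifted solution lives on [-T/2, 0]. Its Wronskians with the solution itself and with the
  -- reflected solution are compared at the two ends, where `alpha` and `beta` are evaluated only at
  -- ±1.
  have w1 := (h.mono le_rfl hτ.le).wronskian (by linarith) hs
  have w2 := hs.wronskian (by linarith) (h.reflect.mono le_rfl hτ.le)
  have hcp := circlePoint_half_period hω.ne'
  have hcp' : circlePoint ω (-(period ω / 2)) = -1 := by rw [circlePoint_neg, hcp]; norm_num
  have hωc : (ω : ℂ) ≠ 0 := by exact_mod_cast hω.ne'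
  have hsq : ((-1 : ℂ)) ^ l * (-1) ^ l = 1 := by rw [← mul_pow]; simp
  simp only [neg_add_cancel, zero_add, neg_zero, neg_neg, circlePoint_zero, hcp, hcp',
    alpha_neg_one hω.ne', beta_neg_one hω.ne' hl] at w1 w2
  rw [hε, pow_succ]
  rw [pow_succ] at w1 w2
  have hbb : beta ω μ l 1 = 2 * ω * b := by rw [hb]; field_simp
  rw [hbb, ← ha] at w1 w2
  generalize (-1 : ℂ) ^ l = e at hsq w1 w2 ⊢
  have e1 : Complex.I * (2 * ↑ω * b) / (2 * ↑ω) = Complex.I * b := by field_simp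
  rw [e1] at w1 w2
  constructor
  · linear_combination -w1 - (a * y 0 * y (period ω / 2)) * hsq
  · linear_combination -w2 - (a * x 0 * y (period ω / 2)) * hsq

end

section

variable {ω μ : ℝ} {l : ℕ}

/-! ### The linear system in a vicinity of the punctured circle -/

/-- `(ℓ z⁻¹ + μ (1 + z⁻²)) / 2`. -/
noncomputable def halfCoef (μ : ℝ) (l : ℕ) (z : ℂ) : ℂ :=
  ((l : ℂ) * z⁻¹ + (μ : ℂ) * (1 + (z ^ 2)⁻¹)) / 2

/-- `(u, v)` solves the linear system in a vicinity of the punctured circle. -/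
def IsCSys (ω μ : ℝ) (l : ℕ) (u v : ℂ → ℂ) : Prop :=
  ∀ᶠ z in 𝓝ˢ puncturedCircle,
    HasDerivAt u ((2 * Complex.I * (ω : ℂ) * z)⁻¹ * v z + halfCoef μ l z * u z) z ∧
    HasDerivAt v ((2 * Complex.I * (ω : ℂ) * z)⁻¹ * u z - halfCoef μ l z * v z) z

theorem eventually_eventually_puncturedCircle {p : ℂ → Prop}
    (h : ∀ᶠ z in 𝓝ˢ puncturedCircle, p z) :
    ∀ᶠ z in 𝓝ˢ puncturedCircle, ∀ᶠ w in 𝓝 z, p w := by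
  rw [eventually_nhdsSet_iff_forall] at h ⊢
  exact fun z hz => (h z hz).eventually_nhds

theorem eventually_analyticAt {f : ℂ → ℂ}
    (h : ∀ᶠ z in 𝓝ˢ puncturedCircle, DifferentiableAt ℂ f z) :
    ∀ᶠ z in 𝓝ˢ puncturedCircle, AnalyticAt ℂ f z :=
  (eventually_eventually_puncturedCircle h).mono fun _ hz =>
    Complex.analyticAt_iff_eventually_differentiableAt.mpr hz

theorem eventually_ne_of_ne_on_circle (hω : 0 < ω) {f : ℂ → ℂ}
    (hf : ∀ᶠ z in 𝓝ˢ puncturedCircle, AnalyticAt ℂ f z)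
    (h : ∀ t ∈ Ioo (-(period ω / 2)) (period ω / 2), f (circlePoint ω t) ≠ 0) :
    ∀ᶠ z in 𝓝ˢ puncturedCircle, f z ≠ 0 := by
  rw [eventually_puncturedCircle hω] at hf ⊢
  exact fun t ht => (hf t ht).self_of_nhds.continuousAt.eventually_ne (h t ht)

theorem at_circlePoint (hω : 0 < ω) {p : ℂ → Prop} (h : ∀ᶠ z in 𝓝ˢ puncturedCircle, p z) {t : ℝ}
    (ht : t ∈ Ioo (-(period ω / 2)) (period ω / 2)) : p (circlePoint ω t) :=
  ((eventually_puncturedCircle hω).mp h t ht).self_of_nhds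

theorem IsCSys.analytic_fst {u v : ℂ → ℂ} (h : IsCSys ω μ l u v) :
    ∀ᶠ z in 𝓝ˢ puncturedCircle, AnalyticAt ℂ u z :=
  eventually_analyticAt (h.mono fun _ hz => hz.1.differentiableAt)

theorem IsCSys.analytic_snd {u v : ℂ → ℂ} (h : IsCSys ω μ l u v) :
    ∀ᶠ z in 𝓝ˢ puncturedCircle, AnalyticAt ℂ v z :=
  eventually_analyticAt (h.mono fun _ hz => hz.2.differentiableAt)

theorem IsCSys.linComb {u v u' v' : ℂ → ℂ} (h : IsCSys ω μ l u v) (h' : IsCSys ω μ l u' v')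
    (A C : ℂ) : IsCSys ω μ l (fun z => A * u z + C * u' z) (fun z => A * v z + C * v' z) := by
  filter_upwards [h, h'] with z hz hz'
  exact ⟨((hz.1.const_mul A).add (hz'.1.const_mul C)).congr_deriv (by ring),
    ((hz.2.const_mul A).add (hz'.2.const_mul C)).congr_deriv (by ring)⟩

theorem IsCSys.reflect (hω : 0 < ω) {u v : ℂ → ℂ} (h : IsCSys ω μ l u v) :
    IsCSys ω μ l (fun z => v (1 / z)) (fun z => -u (1 / z)) := by
  have hωc : (ω : ℂ) ≠ 0 := by exact_mod_cast hω.ne'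
  filter_upwards [eventually_inv_puncturedCircle hω h, eventually_ne_zero_puncturedCircle]
    with z hz h0
  simp only [one_div]
  have hi := Complex.I_ne_zero
  refine ⟨(hz.2.comp_of_eq z (hasDerivAt_inv h0) rfl).congr_deriv ?_,
    (hz.1.comp_of_eq z (hasDerivAt_inv h0) rfl).neg.congr_deriv ?_⟩
  · simp only [halfCoef]
    field_simp
    ring
  · simp only [halfCoef]
    field_simp
    ring

theorem IsCSys.hasDerivAt_circle (hω : 0 < ω) {u v : ℂ → ℂ} (h : IsCSys ω μ l u v) {t : ℝ}
    (ht : t ∈ Ioo (-(period ω / 2)) (period ω / 2)) :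
    HasDerivAt (fun t => u (circlePoint ω t)) (1 / 2 * v (circlePoint ω t)
      + Complex.I * drive ω μ l t / 2 * u (circlePoint ω t)) t ∧
    HasDerivAt (fun t => v (circlePoint ω t)) (1 / 2 * u (circlePoint ω t)
      - Complex.I * drive ω μ l t / 2 * v (circlePoint ω t)) t := by
  have hωc : (ω : ℂ) ≠ 0 := by exact_mod_cast hω.ne'
  have hz := at_circlePoint hω h ht
  have h0 := circlePoint_ne_zero (ω := ω) t
  have hs := circlePoint_add_neg (ω := ω) t
  rw [circlePoint_neg] at hs
  have hi := Complex.I_ne_zero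
  have hd : drive ω μ l t = ω * (l + μ * (circlePoint ω t + (circlePoint ω t)⁻¹)) := by
    rw [hs, drive]; ring
  refine ⟨(hz.1.comp_of_eq t (hasDerivAt_circlePoint t) rfl).congr_deriv ?_,
    (hz.2.comp_of_eq t (hasDerivAt_circlePoint t) rfl).congr_deriv ?_⟩
  · rw [hd]
    simp only [halfCoef]
    field_simp
  · rw [hd]
    simp only [halfCoef]
    field_simp

theorem IsRiccatiSolution.hasDerivAt_circle (hω : 0 < ω) {Φ : ℂ → ℂ}
    (h : IsRiccatiSolution ω μ l Φ) {t : ℝ} (ht : t ∈ Ioo (-(period ω / 2)) (period ω / 2)) :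
    HasDerivAt (fun t => Φ (circlePoint ω t)) (1 / 2 * (1 - Φ (circlePoint ω t) ^ 2)
      + Complex.I * drive ω μ l t * Φ (circlePoint ω t)) t := by
  have hωc : (ω : ℂ) ≠ 0 := by exact_mod_cast hω.ne'
  have hz := at_circlePoint hω h ht
  have h0 := circlePoint_ne_zero (ω := ω) t
  have hs := circlePoint_add_neg (ω := ω) t
  rw [circlePoint_neg] at hs
  have hi := Complex.I_ne_zero
  have hd : drive ω μ l t = ω * (l + μ * (circlePoint ω t + (circlePoint ω t)⁻¹)) := by
    rw [hs, drive]; ring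
  refine (hz.comp_of_eq t (hasDerivAt_circlePoint t) rfl).congr_deriv ?_
  rw [hd]
  field_simp

theorem IsLinearSolution.hasDerivAt_circle (hω : 0 < ω) {Φ Ψ : ℂ → ℂ}
    (h : IsLinearSolution ω Φ Ψ) {t : ℝ} (ht : t ∈ Ioo (-(period ω / 2)) (period ω / 2)) :
    Φ (circlePoint ω t) ≠ 0 ∧ HasDerivAt (fun t => Ψ (circlePoint ω t))
      (1 / 2 * (Φ (circlePoint ω t) + (Φ (circlePoint ω t))⁻¹) * Ψ (circlePoint ω t)) t := by
  obtain ⟨hne, d, hd, he⟩ := at_circlePoint hω h ht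
  refine ⟨hne, (hd.comp_of_eq t (hasDerivAt_circlePoint t) rfl).congr_deriv ?_⟩
  linear_combination 1 / 2 * he

theorem IsCSys.isRiccatiSolution {u v Φ : ℂ → ℂ} (h : IsCSys ω μ l u v)
    (hv : ∀ᶠ z in 𝓝ˢ puncturedCircle, v z ≠ 0)
    (he : ∀ᶠ z in 𝓝ˢ puncturedCircle, Φ z = u z / v z) : IsRiccatiSolution ω μ l Φ := by
  filter_upwards [h, hv, eventually_eventually_puncturedCircle he] with z hz hvz hez
  refine ((hz.1.div hz.2 hvz).congr_of_eventuallyEq hez).congr_deriv ?_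
  rw [hez.self_of_nhds, halfCoef]
  generalize (2 * Complex.I * (ω : ℂ) * z)⁻¹ = q
  field_simp
  ring

theorem IsCSys.isLinearSolution (hω : 0 < ω) {u v Φ Ψ : ℂ → ℂ} {κ : ℂ} (h : IsCSys ω μ l u v)
    (hu : ∀ᶠ z in 𝓝ˢ puncturedCircle, u z ≠ 0) (hv : ∀ᶠ z in 𝓝ˢ puncturedCircle, v z ≠ 0)
    (he : ∀ᶠ z in 𝓝ˢ puncturedCircle, Φ z = u z / v z)
    (he' : ∀ᶠ z in 𝓝ˢ puncturedCircle, Ψ z = κ * (u z * v z)) : IsLinearSolution ω Φ Ψ := by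
  have hωc : (ω : ℂ) ≠ 0 := by exact_mod_cast hω.ne'
  filter_upwards [h, hu, hv, he, eventually_eventually_puncturedCircle he',
    eventually_ne_zero_puncturedCircle] with z hz huz hvz hez hez' h0
  refine ⟨by rw [hez]; exact div_ne_zero huz hvz, _,
    ((hz.1.mul hz.2).const_mul κ).congr_of_eventuallyEq hez', ?_⟩
  rw [hez, hez'.self_of_nhds]
  have hi := Complex.I_ne_zero
  field_simp
  ring

/-! ### Properties of solutions on the circle -/

theorem conj_drive (t : ℝ) : (starRingEnd ℂ) (drive ω μ l t) = drive ω μ l t := by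
  simp only [drive, map_mul, map_add, Complex.conj_ofReal, Complex.conj_natCast, map_ofNat]

theorem continuous_drive : Continuous (drive ω μ l) := by
  unfold drive
  fun_prop

/-- On the circle 1 - |Φ|² satisfies a homogeneous linear equation with coefficient -Re Φ, and it
vanishes at z = 1. -/
theorem IsRiccatiSolution.norm_eq_one (hω : 0 < ω) {Φ : ℂ → ℂ} (h : IsRiccatiSolution ω μ l Φ)
    (h1 : ‖Φ 1‖ = 1) {t : ℝ} (ht : t ∈ Ioo (-(period ω / 2)) (period ω / 2)) :
    Φ (circlePoint ω t) * (starRingEnd ℂ) (Φ (circlePoint ω t)) = 1 := by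
  have hc : ContinuousOn (fun t => Φ (circlePoint ω t)) (Ioo (-(period ω / 2)) (period ω / 2)) :=
    fun s hs => (h.hasDerivAt_circle hω hs).continuousAt.continuousWithinAt
  have hz := eq_zero_of_linear (zero_mem_half hω)
    (d := fun t => 1 - Φ (circlePoint ω t) * (starRingEnd ℂ) (Φ (circlePoint ω t)))
    (k := fun t => -(1 / 2) * (Φ (circlePoint ω t) + (starRingEnd ℂ) (Φ (circlePoint ω t))))
    (fun s hs => by
      have hd := h.hasDerivAt_circle hω hs
      have hd' : HasDerivAt (fun t => (starRingEnd ℂ) (Φ (circlePoint ω t))) _ s := hd.star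
      refine ((hd.mul hd').const_sub 1).congr_deriv ?_
      simp only [← starRingEnd_apply, map_add, map_mul, map_sub, map_pow, map_one, map_div₀,
        map_ofNat, conj_drive, Complex.conj_I]
      ring)
    (continuousOn_const.mul (hc.add (Complex.continuous_conj.comp_continuousOn hc)))
    (by simp [circlePoint_zero, Complex.mul_conj, Complex.normSq_eq_norm_sq, h1]) ht
  exact (sub_eq_zero.mp hz).symm

/-! ### Existence of the phase and of the half-powers. -/

theorem phaseIntegral_zero (φ : ℝ → ℝ) : phaseIntegral φ 0 = 0 := by simp [phaseIntegral]

theorem continuousOn_phaseIntegral {φ : ℝ → ℝ} {τ : ℝ} (hτ : 0 < τ)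
    (h : ContinuousOn φ (Icc (-τ) τ)) : ContinuousOn (phaseIntegral φ) (Icc (-τ) τ) := by
  have hc : ContinuousOn (fun t => Real.cos (φ t)) (uIcc (-τ) τ) := by
    rw [uIcc_of_le (by linarith)]; exact Real.continuous_cos.comp_continuousOn h
  have := intervalIntegral.continuousOn_primitive_interval' (μ := MeasureTheory.volume)
    hc.intervalIntegrable (a := 0)
    (by rw [uIcc_of_le (by linarith)]; exact ⟨by linarith, hτ.le⟩)
  rwa [uIcc_of_le (by linarith)] at this

theorem hasDerivAt_phaseIntegral {φ : ℝ → ℝ} {τ : ℝ} (hτ : 0 < τ)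
    (h : ContinuousOn φ (Icc (-τ) τ)) {t : ℝ} (ht : t ∈ Ioo (-τ) τ) :
    HasDerivAt (phaseIntegral φ) (Real.cos (φ t)) t := by
  have hc : ContinuousOn (fun t => Real.cos (φ t)) (Icc (-τ) τ) :=
    Real.continuous_cos.comp_continuousOn h
  apply intervalIntegral.integral_hasDerivAt_right
  · apply ContinuousOn.intervalIntegrable
    exact hc.mono (uIcc_subset_Icc ⟨by linarith, hτ.le⟩ (Ioo_subset_Icc_self ht))
  · exact (hc.mono Ioo_subset_Icc_self).stronglyMeasurableAtFilter isOpen_Ioo t ht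
  · exact (hc.mono Ioo_subset_Icc_self).continuousAt (Ioo_mem_nhds ht.1 ht.2)

theorem IsRiccatiSolution.exists_phase (hω : 0 < ω) {Φ : ℂ → ℂ} (h : IsRiccatiSolution ω μ l Φ)
    (h1 : ‖Φ 1‖ = 1) : ∃ φ : ℝ → ℝ, Continuous φ ∧
      ∀ t ∈ Ioo (-(period ω / 2)) (period ω / 2),
        Φ (circlePoint ω t) = Complex.exp (Complex.I * (φ t : ℂ)) := by
  set τ := period ω / 2 with hτ
  have hc : ContinuousOn (fun t => Φ (circlePoint ω t)) (Ioo (-τ) τ) :=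
    fun s hs => (h.hasDerivAt_circle hω hs).continuousAt.continuousWithinAt
  -- For Φ = e^{iφ} the Riccati equation reads φ' = `drive` - sin φ, and sin φ = Im Φ. The phase is
  -- obtained by integrating this.
  set f : ℝ → ℝ := fun t => (drive ω μ l t).re - (Φ (circlePoint ω t)).im with hf
  have hfc : ContinuousOn f (Ioo (-τ) τ) :=
    (Complex.continuous_re.comp continuous_drive).continuousOn.sub
      (Complex.continuous_im.comp_continuousOn hc)
  have hnorm : ∀ t ∈ Ioo (-τ) τ, ‖Φ (circlePoint ω t)‖ = 1 := fun t ht => by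
    have := h.norm_eq_one hω h1 ht
    rw [Complex.mul_conj, Complex.normSq_eq_norm_sq] at this
    have h2 : ‖Φ (circlePoint ω t)‖ ^ 2 = 1 := by exact_mod_cast this
    nlinarith [norm_nonneg (Φ (circlePoint ω t))]
  obtain ⟨M, hM⟩ := isCompact_Icc.exists_bound_of_continuousOn
    (continuous_drive (ω := ω) (μ := μ) (l := l)).continuousOn (s := Icc (-τ) τ)
  have hM0 : 0 ≤ M := (norm_nonneg _).trans
    (hM 0 ⟨by linarith [half_period_pos hω], (half_period_pos hω).le⟩)
  -- Boundedness of f makes its extension by zero integrable on ℝ, so the primitive is continuous up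
  -- to and including ±T/2.
  have hint : MeasureTheory.Integrable ((Ioo (-τ) τ).indicator f) := by
    rw [MeasureTheory.integrable_indicator_iff measurableSet_Ioo]
    refine MeasureTheory.IntegrableOn.of_bound (by simp)
      (hfc.aestronglyMeasurable measurableSet_Ioo) (M + 1) ?_
    rw [MeasureTheory.ae_restrict_iff' measurableSet_Ioo]
    refine Eventually.of_forall fun t ht => ?_
    refine (norm_sub_le _ _).trans (add_le_add ?_ ?_)
    · exact (Complex.abs_re_le_norm _).trans (hM t (Ioo_subset_Icc_self ht))
    · exact (Complex.abs_im_le_norm _).trans (hnorm t ht).le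
  set φ : ℝ → ℝ := fun t => (Φ 1).arg + ∫ s in (0 : ℝ)..t, (Ioo (-τ) τ).indicator f s with hφ
  refine ⟨φ, continuous_const.add
    (intervalIntegral.continuous_primitive (fun a b => hint.intervalIntegrable) 0), ?_⟩
  have hφd : ∀ t ∈ Ioo (-τ) τ, HasDerivAt φ (f t) t := fun t ht => by
    have hnhds := Ioo_mem_nhds ht.1 ht.2
    have := intervalIntegral.integral_hasDerivAt_right (hint.intervalIntegrable (a := 0) (b := t))
      ⟨univ, univ_mem, hint.aestronglyMeasurable.restrict⟩
      ((hfc.continuousAt hnhds).congr (by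
        filter_upwards [hnhds] with s hs using (indicator_of_mem hs f).symm))
    rw [indicator_of_mem ht] at this
    exact this.const_add _
  intro t ht
  have hz := eq_zero_of_linear (zero_mem_half hω) (k := fun _ => 0)
    (d := fun t => Φ (circlePoint ω t) * Complex.exp (-(Complex.I * (φ t : ℂ))) - 1)
    (fun s hs => by
      have hd := h.hasDerivAt_circle hω hs
      have he := ((hφd s hs).ofReal_comp.const_mul Complex.I).neg.cexp
      refine ((hd.mul he).sub_const 1).congr_deriv ?_
      have hn := h.norm_eq_one hω h1 hs
      have hre : ((drive ω μ l s).re : ℂ) = drive ω μ l s :=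
        Complex.conj_eq_iff_re.mp (conj_drive s)
      have him : ((Φ (circlePoint ω s)).im : ℂ) * (2 * Complex.I)
          = Φ (circlePoint ω s) - (starRingEnd ℂ) (Φ (circlePoint ω s)) := by
        rw [Complex.sub_conj]; push_cast; ring
      simp only [hf]
      push_cast
      rw [hre]
      simp only [Pi.neg_apply]
      linear_combination (Complex.exp (-(Complex.I * (φ s : ℂ)))) *
        (1 / 2 * Φ (circlePoint ω s) * him - 1 / 2 * hn))
    continuousOn_const
    (by
      have : φ 0 = (Φ 1).arg := by simp [hφ]
      rw [circlePoint_zero, this]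
      have h2 := Complex.norm_mul_exp_arg_mul_I (Φ 1)
      rw [h1, Complex.ofReal_one, one_mul, mul_comm] at h2
      rw [Complex.exp_neg, h2, mul_inv_cancel₀, sub_self]
      intro h0; rw [h0] at h1; simp at h1) ht
  have hz' := sub_eq_zero.mp hz
  rw [Complex.exp_neg] at hz'
  exact (mul_inv_eq_one₀ (Complex.exp_ne_zero _)).mp hz'

/-- Near z the function h must agree with the principal-branch root normalised to h(z): the product
of h - k and h + k is zero, and h + k is nonzero by continuity. -/
theorem analyticAt_of_sq {h f : ℂ → ℂ} {z : ℂ} (hc : ContinuousAt h z) (hf : AnalyticAt ℂ f z)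
    (hs : ∀ᶠ w in 𝓝 z, h w ^ 2 = f w) (h0 : h z ≠ 0) : AnalyticAt ℂ h z := by
  have hfz : f z = h z ^ 2 := hs.self_of_nhds.symm
  have hf0 : f z ≠ 0 := by rw [hfz]; exact pow_ne_zero 2 h0
  set k : ℂ → ℂ := fun w => h z * (f w / f z) ^ (((2 : ℕ) : ℂ)⁻¹) with hk
  have hka : AnalyticAt ℂ k z := by
    apply analyticAt_const.mul
    apply (hf.div_const).cpow analyticAt_const
    rw [div_self hf0]; exact Complex.one_mem_slitPlane
  have hkz : k z = h z := by simp [hk, div_self hf0]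
  have hne : ∀ᶠ w in 𝓝 z, h w + k w ≠ 0 := by
    apply (hc.add hka.continuousAt).eventually_ne
    rw [Pi.add_apply, hkz, ← two_mul]; exact mul_ne_zero two_ne_zero h0
  refine hka.congr ?_
  filter_upwards [hs, hne] with w hw hnw
  have hk2 : k w ^ 2 = f w := by
    rw [hk]
    simp only
    rw [mul_pow, Complex.cpow_nat_inv_pow _ two_ne_zero, ← hfz]
    field_simp
  have : (h w - k w) * (h w + k w) = 0 := by linear_combination hw - hk2
  exact (sub_eq_zero.mp ((mul_eq_zero.mp this).resolve_right hnw)).symm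

theorem exists_isHalfPower (hω : 0 < ω) {f : ℂ → ℂ} {g : ℝ → ℂ}
    (hf : ∀ᶠ z in 𝓝ˢ puncturedCircle, AnalyticAt ℂ f z)
    (hg : ContinuousOn g (Ioo (-(period ω / 2)) (period ω / 2)))
    (hg2 : ∀ t ∈ Ioo (-(period ω / 2)) (period ω / 2), g t ^ 2 = f (circlePoint ω t))
    (hg0 : ∀ t, g t ≠ 0) : ∃ h, IsHalfPower ω f g h := by
  -- The prescribed root at the radial projection of z, times the principal root of a ratio that is
  -- 1 on the circle. This is continuous near the circle and squares to f, hence analytic.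
  set h : ℂ → ℂ := fun z => g (z.arg / ω) * (f z / f (z / ‖z‖)) ^ (((2 : ℕ) : ℂ)⁻¹) with hh
  have hωc : (ω : ℂ) ≠ 0 := by exact_mod_cast hω.ne'
  have hf0 : ∀ t ∈ Ioo (-(period ω / 2)) (period ω / 2), f (circlePoint ω t) ≠ 0 :=
    fun t ht => by rw [← hg2 t ht]; exact pow_ne_zero 2 (hg0 t)
  have hcirc : ∀ t ∈ Ioo (-(period ω / 2)) (period ω / 2), h (circlePoint ω t) = g t := by
    intro t ht
    simp only [hh]
    rw [arg_circlePoint hω ht, norm_circlePoint, Complex.ofReal_one, div_one,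
      div_self (hf0 t ht), Complex.one_cpow, mul_one, mul_div_cancel_left₀ _ hω.ne']
  refine ⟨h, ?_, hcirc⟩
  rw [eventually_puncturedCircle hω] at hf ⊢
  intro t ht
  have hfa := (hf t ht).self_of_nhds
  have hslit : circlePoint ω t ∈ Complex.slitPlane := by
    rw [Complex.mem_slitPlane_iff_arg, arg_circlePoint hω ht]
    refine ⟨?_, circlePoint_ne_zero t⟩
    have := ht.2
    rw [half_period, lt_div_iff₀ hω] at this
    linarith
  have hsq : ∀ᶠ z in 𝓝 (circlePoint ω t), h z ^ 2 = f z := by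
    filter_upwards [Complex.isOpen_slitPlane.mem_nhds hslit] with z hz
    have hz0 := Complex.slitPlane_ne_zero hz
    have hzn : z / ‖z‖ ∈ puncturedCircle := by
      have hn : (‖z‖ : ℂ) ≠ 0 := by exact_mod_cast norm_ne_zero_iff.mpr hz0
      refine ⟨by simp [hz0], fun hneg => ?_⟩
      rw [div_eq_iff hn] at hneg
      rw [Complex.mem_slitPlane_iff_arg, hneg] at hz
      apply hz.1
      rw [show (-1 : ℂ) * ‖z‖ = ((-‖z‖ : ℝ) : ℂ) by push_cast; ring]
      exact Complex.arg_ofReal_of_neg (by simpa using hz0)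
    obtain ⟨e1, e2⟩ := exists_circlePoint hω hzn
    have harg : (z / ‖z‖).arg = z.arg := by
      rw [div_eq_mul_inv, mul_comm, ← Complex.ofReal_inv]
      exact Complex.arg_real_mul z (by simpa using hz0)
    rw [harg] at e1 e2
    have hne := hf0 _ e1
    simp only [hh]
    rw [mul_pow, Complex.cpow_nat_inv_pow _ two_ne_zero, hg2 _ e1, e2]
    rw [e2] at hne
    field_simp
  have hcont : ContinuousAt h (circlePoint ω t) := by
    apply ContinuousAt.mul
    · have h1 : ContinuousAt (fun z : ℂ => z.arg / ω) (circlePoint ω t) :=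
        (Complex.continuousAt_arg hslit).div_const ω
      refine ContinuousAt.comp_of_eq (y := t) (hg.continuousAt (Ioo_mem_nhds ht.1 ht.2)) h1 ?_
      rw [arg_circlePoint hω ht, mul_div_cancel_left₀ _ hω.ne']
    · have e1 : circlePoint ω t / (‖circlePoint ω t‖ : ℂ) = circlePoint ω t := by
        rw [norm_circlePoint]; simp
      have h1 : ContinuousAt (fun z : ℂ => z / (‖z‖ : ℂ)) (circlePoint ω t) := by
        apply continuousAt_id.div (Complex.continuous_ofReal.comp continuous_norm).continuousAt
        simp [norm_circlePoint]
      have h2 : ContinuousAt (fun z : ℂ => f (z / (‖z‖ : ℂ))) (circlePoint ω t) :=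
        ContinuousAt.comp_of_eq (y := circlePoint ω t) hfa.continuousAt h1 e1
      refine (hfa.continuousAt.div h2 ?_).cpow continuousAt_const ?_
      · rw [e1]; exact hf0 t ht
      · rw [Pi.div_apply, e1, div_self (hf0 t ht)]; exact Complex.one_mem_slitPlane
  have hana := analyticAt_of_sq hcont hfa hsq (by rw [hcirc t ht]; exact hg0 t)
  exact hana.eventually_analyticAt.and hsq

theorem IsRiccatiSolution.analytic {Φ : ℂ → ℂ} (h : IsRiccatiSolution ω μ l Φ) :
    ∀ᶠ z in 𝓝ˢ puncturedCircle, AnalyticAt ℂ Φ z :=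
  eventually_analyticAt (h.mono fun _ hz => hz.differentiableAt)

theorem IsLinearSolution.analytic {Φ Ψ : ℂ → ℂ} (h : IsLinearSolution ω Φ Ψ) :
    ∀ᶠ z in 𝓝ˢ puncturedCircle, AnalyticAt ℂ Ψ z :=
  eventually_analyticAt (h.mono fun _ hz => hz.2.choose_spec.1.differentiableAt)

theorem IsSolutionPair.psi_eq (hω : 0 < ω) {Φ Ψ : ℂ → ℂ} (h : IsSolutionPair ω μ l Φ Ψ)
    {φ : ℝ → ℝ} (hc : ContinuousOn φ (Icc (-(period ω / 2)) (period ω / 2)))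
    (he : ∀ t ∈ Ioo (-(period ω / 2)) (period ω / 2),
      Φ (circlePoint ω t) = Complex.exp (Complex.I * (φ t : ℂ)))
    {t : ℝ} (ht : t ∈ Ioo (-(period ω / 2)) (period ω / 2)) :
    Ψ (circlePoint ω t) = Complex.exp (phaseIntegral φ t : ℂ) := by
  have hz := eq_zero_of_linear (zero_mem_half hω) (k := fun _ => 0)
    (d := fun t => Ψ (circlePoint ω t) * Complex.exp (-(phaseIntegral φ t : ℂ)) - 1)
    (fun s hs => by
      have hd := (h.linear.hasDerivAt_circle hω hs).2
      have hp := (hasDerivAt_phaseIntegral (half_period_pos hω) hc hs).ofReal_comp.neg.cexp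
      refine ((hd.mul hp).sub_const 1).congr_deriv ?_
      rw [he s hs, ← Complex.exp_neg, Complex.ofReal_cos, Complex.cos]
      simp only [Pi.neg_apply]
      rw [show -(Complex.I * (φ s : ℂ)) = -(φ s : ℂ) * Complex.I by ring,
        mul_comm Complex.I (φ s : ℂ)]
      ring)
    continuousOn_const (by simp [circlePoint_zero, phaseIntegral_zero, h.psi_one]) ht
  have hz' := sub_eq_zero.mp hz
  rw [Complex.exp_neg] at hz'
  exact (mul_inv_eq_one₀ (Complex.exp_ne_zero _)).mp hz'

theorem IsSolutionPair.exists_branches (hω : 0 < ω) {Φ Ψ : ℂ → ℂ}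
    (h : IsSolutionPair ω μ l Φ Ψ) : ∃ b : Branches, b.IsFor ω Φ Ψ := by
  obtain ⟨φ, hφ, he⟩ := h.riccati.exists_phase hω h.norm_phi_one
  have hP := continuousOn_phaseIntegral (half_period_pos hω) hφ.continuousOn
  obtain ⟨r, hr⟩ := exists_isHalfPower hω h.riccati.analytic
    (g := fun t => Complex.exp (Complex.I * (φ t : ℂ) / 2))
    (by fun_prop)
    (fun t ht => by rw [he t ht, ← Complex.exp_nat_mul]; congr 1; push_cast; ring)
    (fun t => Complex.exp_ne_zero _)
  obtain ⟨s, hs⟩ := exists_isHalfPower hω h.linear.analytic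
    (g := fun t => Complex.exp ((phaseIntegral φ t : ℂ) / 2))
    (Complex.continuous_exp.comp_continuousOn
      ((Complex.continuous_ofReal.comp_continuousOn (hP.mono Ioo_subset_Icc_self)).div_const 2))
    (fun t ht => by
      rw [h.psi_eq hω hφ.continuousOn he ht, ← Complex.exp_nat_mul]; congr 1; push_cast; ring)
    (fun t => Complex.exp_ne_zero _)
  exact ⟨⟨φ, r, s⟩, hφ.continuousOn, he, hr, hs⟩

end

section

variable {ω μ : ℝ} {l : ℕ}

/-! ### The values of the half-powers on the circle -/

/-- `e^{(P(t) + iφ(t))/2}`. -/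
noncomputable def xF (b : Branches) (t : ℝ) : ℂ :=
  Complex.exp ((phaseIntegral b.phase t : ℂ) / 2) * ePhase b t

/-- `e^{(P(t) - iφ(t))/2}`. -/
noncomputable def yF (b : Branches) (t : ℝ) : ℂ :=
  Complex.exp ((phaseIntegral b.phase t : ℂ) / 2) * ePhaseInv b t

theorem xF_ne_zero (b : Branches) (t : ℝ) : xF b t ≠ 0 :=
  mul_ne_zero (Complex.exp_ne_zero _) (Complex.exp_ne_zero _)

theorem yF_ne_zero (b : Branches) (t : ℝ) : yF b t ≠ 0 :=
  mul_ne_zero (Complex.exp_ne_zero _) (Complex.exp_ne_zero _)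

theorem conj_xF (b : Branches) (t : ℝ) : (starRingEnd ℂ) (xF b t) = yF b t := by
  simp only [xF, yF, ePhase, ePhaseInv, map_mul, ← Complex.exp_conj, map_div₀, map_ofNat,
    Complex.conj_ofReal, Complex.conj_I]
  congr 2; ring

theorem conj_yF (b : Branches) (t : ℝ) : (starRingEnd ℂ) (yF b t) = xF b t := by
  rw [← conj_xF, Complex.conj_conj]

variable {Φ Ψ : ℂ → ℂ} {b : Branches}

theorem Branches.IsFor.rootMul_circle (hb : b.IsFor ω Φ Ψ) {t : ℝ}
    (ht : t ∈ Ioo (-(period ω / 2)) (period ω / 2)) : rootMul b (circlePoint ω t) = xF b t := by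
  rw [rootMul, hb.rootPhi_eq.2 t ht, hb.rootPsi_eq.2 t ht]; rfl

theorem Branches.IsFor.rootDiv_circle (hb : b.IsFor ω Φ Ψ) {t : ℝ}
    (ht : t ∈ Ioo (-(period ω / 2)) (period ω / 2)) : rootDiv b (circlePoint ω t) = yF b t := by
  rw [rootDiv, hb.rootPhi_eq.2 t ht, hb.rootPsi_eq.2 t ht, ← Complex.exp_neg]; rfl

theorem Branches.IsFor.xF_eq (hb : b.IsFor ω Φ Ψ) {t : ℝ}
    (ht : t ∈ Ioo (-(period ω / 2)) (period ω / 2)) : xF b t = Φ (circlePoint ω t) * yF b t := by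
  rw [hb.phase_eq t ht, xF, yF, ePhase, ePhaseInv]
  simp only [← Complex.exp_add]
  congr 1; ring

theorem Branches.IsFor.xF_mul_yF (hω : 0 < ω) (hb : b.IsFor ω Φ Ψ) {t : ℝ}
    (ht : t ∈ Ioo (-(period ω / 2)) (period ω / 2)) : xF b t * yF b t = Ψ (circlePoint ω t) := by
  have h1 := (at_circlePoint hω hb.rootPsi_eq.1 ht).2
  rw [hb.rootPsi_eq.2 t ht] at h1
  rw [← h1, xF, yF, ePhase, ePhaseInv, Complex.exp_neg]
  have := Complex.exp_ne_zero (Complex.I * (b.phase t : ℂ) / 2)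
  field_simp

/-- The half-sum and half-difference of the logarithmic derivatives of Ψ and Φ turn (1), (2) into a
linear system. -/
theorem IsSolutionPair.isCSys (hω : 0 < ω) (h : IsSolutionPair ω μ l Φ Ψ) (hb : b.IsFor ω Φ Ψ) :
    IsCSys ω μ l (rootMul b) (rootDiv b) := by
  have hωc : (ω : ℂ) ≠ 0 := by exact_mod_cast hω.ne'
  have n1 := eventually_ne_of_ne_on_circle hω (hb.rootPhi_eq.1.mono fun _ hz => hz.1)
    (fun t ht => by rw [hb.rootPhi_eq.2 t ht]; exact Complex.exp_ne_zero _)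
  have n2 := eventually_ne_of_ne_on_circle hω (hb.rootPsi_eq.1.mono fun _ hz => hz.1)
    (fun t ht => by rw [hb.rootPsi_eq.2 t ht]; exact Complex.exp_ne_zero _)
  filter_upwards [h.riccati, h.linear, eventually_eventually_puncturedCircle hb.rootPhi_eq.1,
    eventually_eventually_puncturedCircle hb.rootPsi_eq.1, n1, n2,
    eventually_ne_zero_puncturedCircle] with z hR hL hf hs hf0 hs0 hz0
  obtain ⟨_, d, hd, he⟩ := hL
  have ef := hf.self_of_nhds
  have es := hs.self_of_nhds
  have df := ef.1.differentiableAt.hasDerivAt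
  have ds := es.1.differentiableAt.hasDerivAt
  have hi := Complex.I_ne_zero
  have hdf : deriv b.rootPhi z = ((2 * Complex.I * (ω : ℂ) * z)⁻¹ * (1 - b.rootPhi z ^ 4)
      + 2 * halfCoef μ l z * b.rootPhi z ^ 2) / (2 * b.rootPhi z) := by
    have := (hR.congr_of_eventuallyEq (hf.mono fun w hw => hw.2)).unique (df.pow 2)
    rw [eq_div_iff (mul_ne_zero two_ne_zero hf0)]
    rw [← ef.2] at this
    simp only [halfCoef]
    push_cast at this
    linear_combination -this
  have hds : deriv b.rootPsi z = ((2 * Complex.I * (ω : ℂ) * z)⁻¹ *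
      (b.rootPhi z ^ 2 + (b.rootPhi z ^ 2)⁻¹) * b.rootPsi z ^ 2) / (2 * b.rootPsi z) := by
    have := (hd.congr_of_eventuallyEq (hs.mono fun w hw => hw.2)).unique (ds.pow 2)
    rw [eq_div_iff (mul_ne_zero two_ne_zero hs0)]
    rw [← es.2, ← ef.2] at he
    have hd' : d = (2 * Complex.I * (ω : ℂ) * z)⁻¹ * ((b.rootPhi z ^ 2 + (b.rootPhi z ^ 2)⁻¹)
        * b.rootPsi z ^ 2) := by
      rw [← he, inv_mul_cancel_left₀]
      exact mul_ne_zero (mul_ne_zero (mul_ne_zero two_ne_zero hi) hωc) hz0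
    rw [hd'] at this
    push_cast at this
    linear_combination -this
  refine ⟨(ds.mul df).congr_deriv ?_, (ds.mul (df.inv hf0)).congr_deriv ?_⟩
  · rw [hdf, hds, rootMul, rootDiv]
    field_simp
    ring
  · rw [hdf, hds, rootMul, rootDiv, Pi.inv_apply]
    field_simp
    ring

theorem IsSolutionPair.isSys (hω : 0 < ω) (h : IsSolutionPair ω μ l Φ Ψ) (hb : b.IsFor ω Φ Ψ) :
    IsSys ω μ l (-(period ω / 2)) (period ω / 2) (xF b) (yF b) := by
  have hP := continuousOn_phaseIntegral (half_period_pos hω) hb.phase_cont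
  have hPc : ContinuousOn (fun t => Complex.exp ((phaseIntegral b.phase t : ℂ) / 2))
      (Icc (-(period ω / 2)) (period ω / 2)) :=
    Complex.continuous_exp.comp_continuousOn
      ((Complex.continuous_ofReal.comp_continuousOn hP).div_const 2)
  have hφ : ContinuousOn (fun t => Complex.I * (b.phase t : ℂ) / 2)
      (Icc (-(period ω / 2)) (period ω / 2)) :=
    (continuousOn_const.mul (Complex.continuous_ofReal.comp_continuousOn hb.phase_cont)).div_const 2
  have hev : ∀ {t : ℝ}, t ∈ Ioo (-(period ω / 2)) (period ω / 2) →
      ∀ᶠ s in 𝓝 t, s ∈ Ioo (-(period ω / 2)) (period ω / 2) := fun ht => Ioo_mem_nhds ht.1 ht.2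
  refine ⟨hPc.mul (Complex.continuous_exp.comp_continuousOn hφ),
    hPc.mul (Complex.continuous_exp.comp_continuousOn hφ.neg), fun t ht => ?_, fun t ht => ?_⟩
  · have := ((h.isCSys hω hb).hasDerivAt_circle hω ht).1
    rw [hb.rootMul_circle ht, hb.rootDiv_circle ht] at this
    exact this.congr_of_eventuallyEq
      ((hev ht).mono fun s hs => (hb.rootMul_circle hs).symm)
  · have := ((h.isCSys hω hb).hasDerivAt_circle hω ht).2
    rw [hb.rootMul_circle ht, hb.rootDiv_circle ht] at this
    exact this.congr_of_eventuallyEq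
      ((hev ht).mono fun s hs => (hb.rootDiv_circle hs).symm)

/-! ### The coefficients of the `B`-transformation -/

theorem coefW_eq (b : Branches) (σ : ℂ) : coefW b σ = xF b 0 + σ * Complex.I * yF b 0 := by
  simp [coefW, xF, yF, phaseIntegral_zero]

theorem ePplus_mul_coefU (σ : ℂ) : ePplus ω b * coefU ω l b σ
    = (-1) ^ l * xF b (period ω / 2) + σ * Complex.I * yF b (period ω / 2) := by
  simp only [ePplus, coefU, xF, yF]; ring

theorem ePminus_mul_coefV (σ : ℂ) : ePminus ω b * coefV ω l b σ
    = xF b (-(period ω / 2)) + σ * Complex.I * (-1) ^ l * yF b (-(period ω / 2)) := by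
  simp only [ePminus, coefV, xF, yF]; ring

/-- The real number `𝔯(1)`. -/
noncomputable def cR (ω μ : ℝ) (l : ℕ) : ℝ := (pqPoly ω μ l l).2.eval 1

/-- The real number `𝔭(1) / (2ω)`. -/
noncomputable def cP (ω μ : ℝ) (l : ℕ) : ℝ := (pqPoly ω μ l l).1.eval 1 / (2 * ω)

theorem cR_eq : (cR ω μ l : ℂ) = alpha ω μ l 1 := alpha_one_eq_ofReal.symm

theorem cP_eq : (cP ω μ l : ℂ) = beta ω μ l 1 / (2 * ω) := by
  rw [beta_one_eq_ofReal, cP]; push_cast; rfl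

theorem Dplus_eq (hω : ω ≠ 0) : Dplus ω μ l = 2 * ω * (cP ω μ l + cR ω μ l) := by
  have hωc : (ω : ℂ) ≠ 0 := by exact_mod_cast hω
  rw [Dplus, polyP_one, polyR_one hω, cR_eq, cP_eq]; field_simp

theorem Dminus_eq (hω : ω ≠ 0) : Dminus ω μ l = 2 * ω * (cP ω μ l - cR ω μ l) := by
  have hωc : (ω : ℂ) ≠ 0 := by exact_mod_cast hω
  rw [Dminus, polyP_one, polyR_one hω, cR_eq, cP_eq]; field_simp

/-- The first component of the shifted solution at `0`. -/
noncomputable def mOne (ω μ : ℝ) (l : ℕ) (b : Branches) : ℂ :=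
  (-1) ^ (l + 1) * Complex.I * cP ω μ l * xF b (period ω / 2) - cR ω μ l * yF b (period ω / 2)

/-- The second component of the shifted solution at `0`. -/
noncomputable def mTwo (ω μ : ℝ) (l : ℕ) (b : Branches) : ℂ :=
  (-1) ^ (l + 1) * cR ω μ l * xF b (period ω / 2) + Complex.I * cP ω μ l * yF b (period ω / 2)

theorem neg_one_pow_mul_self (l : ℕ) : (-1 : ℂ) ^ l * (-1) ^ l = 1 := by rw [← mul_pow]; simp

theorem coefA_eq (hω : ω ≠ 0) : coefA ω μ l b
    = 8 * ω * (-(mOne ω μ l b * xF b 0) - mTwo ω μ l b * yF b 0) := by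
  have h : coefA ω μ l b = 2 * Complex.I * (Dplus ω μ l * coefW b (-1)
      * (ePplus ω b * coefU ω l b (-1)) + Dminus ω μ l * coefW b 1 * (ePplus ω b * coefU ω l b 1)) := by
    rw [coefA]; ring
  rw [h, ePplus_mul_coefU, ePplus_mul_coefU, coefW_eq, coefW_eq, Dplus_eq hω, Dminus_eq hω,
    mOne, mTwo, pow_succ]
  have hI := Complex.I_mul_I
  generalize (-1 : ℂ) ^ l = e
  linear_combination (8 * ω * (Complex.I * cP ω μ l * yF b 0 * yF b (period ω / 2)
    - cR ω μ l * (e * yF b 0 * xF b (period ω / 2) + xF b 0 * yF b (period ω / 2)))) * hI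

/-- The definition adds one expression at T/2 and one at -T/2. The first of the `endpoint_relations`
says that they are equal, so the values at T/2 suffice. -/
theorem IsSolutionPair.coefB_eq (hω : 0 < ω) (hl : 0 < l) (h : IsSolutionPair ω μ l Φ Ψ)
    (hb : b.IsFor ω Φ Ψ) : coefB ω μ l b
      = 8 * ω * (xF b 0 * mTwo ω μ l b - yF b 0 * mOne ω μ l b) := by
  have hr := ((h.isSys hω hb).endpoint_relations hω hl cR_eq cP_eq rfl).1
  have h : coefB ω μ l b = -(Dplus ω μ l) * coefW b (-1)
      * (ePplus ω b * coefU ω l b (-1) + ePminus ω b * coefV ω l b (-1))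
      + Dminus ω μ l * coefW b 1 * (ePplus ω b * coefU ω l b 1 + ePminus ω b * coefV ω l b 1) := rfl
  rw [h, ePplus_mul_coefU, ePplus_mul_coefU, ePminus_mul_coefV, ePminus_mul_coefV, coefW_eq,
    coefW_eq, Dplus_eq hω.ne', Dminus_eq hω.ne', mOne, mTwo]
  rw [pow_succ] at hr ⊢
  have hI := Complex.I_mul_I
  generalize (-1 : ℂ) ^ l = e at hr ⊢
  linear_combination (-4 * ω : ℂ) * hr
    - (4 * ω * cR ω μ l * yF b 0 * (yF b (period ω / 2) + e * yF b (-(period ω / 2)))) * hI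

theorem conj_mOne : (starRingEnd ℂ) (mOne ω μ l b) = -(-1) ^ (l + 1) * mTwo ω μ l b := by
  have hsq := neg_one_pow_mul_self (l + 1)
  simp only [mOne, mTwo, map_sub, map_mul, map_pow, map_neg, map_one, conj_xF, conj_yF,
    Complex.conj_I, Complex.conj_ofReal]
  linear_combination (cR ω μ l * xF b (period ω / 2) : ℂ) * hsq

theorem conj_mTwo : (starRingEnd ℂ) (mTwo ω μ l b) = -(-1) ^ (l + 1) * mOne ω μ l b := by
  have hsq := neg_one_pow_mul_self (l + 1)
  simp only [mOne, mTwo, map_add, map_mul, map_pow, map_neg, map_one, conj_xF, conj_yF,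
    Complex.conj_I, Complex.conj_ofReal]
  linear_combination (Complex.I * cP ω μ l * xF b (period ω / 2) : ℂ) * hsq

/-- Together with `conj_coefB`: of A and C, one is real and the other imaginary, depending on the
parity of ℓ. -/
theorem conj_coefA (hω : ω ≠ 0) :
    (starRingEnd ℂ) (coefA ω μ l b) = -(-1) ^ (l + 1) * coefA ω μ l b := by
  rw [coefA_eq hω]
  simp only [map_sub, map_mul, map_neg, conj_mOne, conj_mTwo, conj_xF, conj_yF,
    Complex.conj_ofReal, map_ofNat]
  ring

theorem IsSolutionPair.conj_coefB (hω : 0 < ω) (hl : 0 < l) (h : IsSolutionPair ω μ l Φ Ψ)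
    (hb : b.IsFor ω Φ Ψ) :
    (starRingEnd ℂ) (coefB ω μ l b) = (-1) ^ (l + 1) * coefB ω μ l b := by
  rw [h.coefB_eq hω hl hb]
  simp only [map_sub, map_mul, conj_mOne, conj_mTwo, conj_xF, conj_yF,
    Complex.conj_ofReal, map_ofNat]
  ring

theorem cR_sq_sub_cP_sq_ne_zero (hω : ω ≠ 0) (hDp : Dplus ω μ l ≠ 0) (hDm : Dminus ω μ l ≠ 0) :
    (cR ω μ l : ℂ) ^ 2 - (cP ω μ l : ℂ) ^ 2 ≠ 0 := by
  intro h0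
  apply mul_ne_zero hDp hDm
  rw [Dplus_eq hω, Dminus_eq hω]
  linear_combination (-4 * (ω : ℂ) ^ 2) * h0

/-- The matrix here is the one giving the shifted solution at -T/2 from (x, y) at 0. Composed with
the matrix that defines `mOne`, `mTwo`, it is scalar, which is why two half-period shifts return the
original vector up to a factor. -/
theorem mOne_mTwo_inv_fst : (-1) ^ (l + 1) * Complex.I * cP ω μ l * mOne ω μ l b
      + (-1) ^ (l + 1) * cR ω μ l * mTwo ω μ l b
    = ((cR ω μ l : ℂ) ^ 2 - (cP ω μ l : ℂ) ^ 2) * xF b (period ω / 2) := by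
  have hsq := neg_one_pow_mul_self (l + 1)
  have hI := Complex.I_mul_I
  rw [mOne, mTwo]
  generalize (-1 : ℂ) ^ (l + 1) = e at hsq ⊢
  linear_combination ((cP ω μ l ^ 2 * Complex.I ^ 2 + cR ω μ l ^ 2) * xF b (period ω / 2)) * hsq
    + (cP ω μ l ^ 2 * xF b (period ω / 2)) * hI

theorem mOne_mTwo_inv_snd : -(cR ω μ l : ℂ) * mOne ω μ l b + Complex.I * cP ω μ l * mTwo ω μ l b
    = ((cR ω μ l : ℂ) ^ 2 - (cP ω μ l : ℂ) ^ 2) * yF b (period ω / 2) := by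
  have hI := Complex.I_mul_I
  rw [mOne, mTwo]
  linear_combination ((cP ω μ l : ℂ) ^ 2 * yF b (period ω / 2)) * hI

/-! ### The transformed functions on the circle -/

theorem Branches.IsFor.numB_circle (hb : b.IsFor ω Φ Ψ) {t : ℝ}
    (ht : t ∈ Ioo (-(period ω / 2)) (period ω / 2)) :
    numB ω μ l b (circlePoint ω t) = coefA ω μ l b * xF b t + coefB ω μ l b * yF b (-t) := by
  rw [numB, hb.rootMul_circle ht, one_div, ← circlePoint_neg, hb.rootDiv_circle (neg_mem_half ht)]

theorem Branches.IsFor.denB_circle (hb : b.IsFor ω Φ Ψ) {t : ℝ}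
    (ht : t ∈ Ioo (-(period ω / 2)) (period ω / 2)) :
    denB ω μ l b (circlePoint ω t) = -(coefA ω μ l b * yF b t) + coefB ω μ l b * xF b (-t) := by
  rw [denB, hb.rootDiv_circle ht, one_div, ← circlePoint_neg, hb.rootMul_circle (neg_mem_half ht),
    neg_mul]

theorem IsSolutionPair.denB_eq_conj (hω : 0 < ω) (hl : 0 < l) (h : IsSolutionPair ω μ l Φ Ψ)
    (hb : b.IsFor ω Φ Ψ) {t : ℝ} (ht : t ∈ Ioo (-(period ω / 2)) (period ω / 2)) :
    denB ω μ l b (circlePoint ω t)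
      = (-1) ^ (l + 1) * (starRingEnd ℂ) (numB ω μ l b (circlePoint ω t)) := by
  rw [hb.numB_circle ht, hb.denB_circle ht]
  simp only [map_add, map_mul, conj_coefA hω.ne', h.conj_coefB hω hl hb, conj_xF, conj_yF]
  linear_combination (coefA ω μ l b * yF b t - coefB ω μ l b * xF b (-t))
    * neg_one_pow_mul_self (l + 1)

/-- The Wronskian of the solution with its reflection, up to sign. -/
theorem IsSolutionPair.xF_mul_neg (hω : 0 < ω) (h : IsSolutionPair ω μ l Φ Ψ)
    (hb : b.IsFor ω Φ Ψ) {t : ℝ} (ht : t ∈ Icc (-(period ω / 2)) (period ω / 2)) :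
    xF b t * xF b (-t) + yF b t * yF b (-t) = xF b 0 ^ 2 + yF b 0 ^ 2 := by
  have hs := h.isSys hω hb
  have hτ := half_period_pos hω
  rcases le_total 0 t with h0 | h0
  · have := (hs.mono (by linarith) ht.2).wronskian h0 (hs.reflect.mono (by linarith) ht.2)
    simp only [neg_zero] at this
    linear_combination this
  · have := (hs.mono ht.1 hτ.le).wronskian h0 (hs.reflect.mono ht.1 hτ.le)
    simp only [neg_zero] at this
    linear_combination -this

theorem Branches.IsFor.sq_add_sq (hω : 0 < ω) (hb : b.IsFor ω Φ Ψ) :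
    xF b 0 ^ 2 + yF b 0 ^ 2 = (Φ 1 ^ 2 + 1) * yF b 0 ^ 2 := by
  have := hb.xF_eq (zero_mem_half hω)
  rw [circlePoint_zero] at this
  rw [this]; ring

theorem Branches.IsFor.sq_add_sq_ne_zero (hω : 0 < ω) (hb : b.IsFor ω Φ Ψ) (hΦ : Φ 1 ^ 2 ≠ -1) :
    xF b 0 ^ 2 + yF b 0 ^ 2 ≠ 0 := by
  rw [hb.sq_add_sq hω]
  refine mul_ne_zero (fun h => hΦ ?_) (pow_ne_zero 2 (yF_ne_zero b 0))
  linear_combination h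

/-- The factor between the transform and the shifted solution. -/
noncomputable def cB (ω : ℝ) (b : Branches) : ℂ := -(8 * ω * (xF b 0 ^ 2 + yF b 0 ^ 2))

/-- A and C are the Cramer coefficients of the shifted vector at t = 0 in the basis (x, y), (y, -x),
cleared of denominators. -/
theorem IsSolutionPair.combination_zero (hω : 0 < ω) (hl : 0 < l) (h : IsSolutionPair ω μ l Φ Ψ)
    (hb : b.IsFor ω Φ Ψ) :
    coefA ω μ l b * xF b 0 + coefB ω μ l b * yF b 0 = cB ω b * mOne ω μ l b ∧
    -(coefA ω μ l b * yF b 0) + coefB ω μ l b * xF b 0 = -(cB ω b * mTwo ω μ l b) := by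
  rw [coefA_eq hω.ne', h.coefB_eq hω hl hb, cB]
  constructor <;> ring

/-- The other sides of the `endpoint_relations` express A and C through the shifted vector at -T/2.
With the Wronskian x(t)x(-t) + y(t)y(-t) this gives the end value by algebra alone. -/
theorem IsSolutionPair.combination_end (hω : 0 < ω) (hl : 0 < l) (h : IsSolutionPair ω μ l Φ Ψ)
    (hb : b.IsFor ω Φ Ψ) :
    coefA ω μ l b * xF b (-(period ω / 2)) + coefB ω μ l b * yF b (period ω / 2)
      = cB ω b * ((-1) ^ (l + 1) * Complex.I * cP ω μ l * xF b 0
        + (-1) ^ (l + 1) * cR ω μ l * yF b 0) ∧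
    -(coefA ω μ l b * yF b (-(period ω / 2))) + coefB ω μ l b * xF b (period ω / 2)
      = -(cB ω b * (-(cR ω μ l : ℂ) * xF b 0 + Complex.I * cP ω μ l * yF b 0)) := by
  obtain ⟨r1, r2⟩ := (h.isSys hω hb).endpoint_relations hω hl cR_eq cP_eq rfl
  have hw := h.xF_mul_neg hω hb (t := period ω / 2)
    ⟨by linarith [half_period_pos hω], le_rfl⟩
  have eA := coefA_eq (ω := ω) (μ := μ) (l := l) (b := b) hω.ne'
  have eB := h.coefB_eq hω hl hb
  have r1' : xF b 0 * mTwo ω μ l b - yF b 0 * mOne ω μ l b = _ := r1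
  have r2' : mOne ω μ l b * xF b 0 + mTwo ω μ l b * yF b 0 = _ := r2
  rw [show -(mOne ω μ l b * xF b 0) - mTwo ω μ l b * yF b 0
    = -(mOne ω μ l b * xF b 0 + mTwo ω μ l b * yF b 0) by ring, r2'] at eA
  rw [r1'] at eB
  rw [eA, eB, cB, ← hw]
  constructor <;> ring

/-- A zero of `numB` on the circle is a zero of `denB`, its conjugate up to sign. The Wronskian is
nonzero since Φ(1)² ≠ -1, so A = C = 0. Then the shifted vector at 0 vanishes, and inverting its
matrix would make y(T/2) zero. -/
theorem IsSolutionPair.numB_circle_ne_zero (hω : 0 < ω) (hl : 0 < l)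
    (hDp : Dplus ω μ l ≠ 0) (hDm : Dminus ω μ l ≠ 0) (h : IsSolutionPair ω μ l Φ Ψ)
    (hΦ : Φ 1 ^ 2 ≠ -1) (hb : b.IsFor ω Φ Ψ) {t : ℝ}
    (ht : t ∈ Ioo (-(period ω / 2)) (period ω / 2)) : numB ω μ l b (circlePoint ω t) ≠ 0 := by
  intro hN
  have hD := h.denB_eq_conj hω hl hb ht
  rw [hN, map_zero, mul_zero, hb.denB_circle ht] at hD
  rw [hb.numB_circle ht] at hN
  have hw := h.xF_mul_neg hω hb (Ioo_subset_Icc_self ht)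
  have hne := hb.sq_add_sq_ne_zero hω hΦ
  have hA : coefA ω μ l b = 0 := by
    have : coefA ω μ l b * (xF b 0 ^ 2 + yF b 0 ^ 2) = 0 := by
      rw [← hw]; linear_combination xF b (-t) * hN - yF b (-t) * hD
    exact (mul_eq_zero.mp this).resolve_right hne
  have hC : coefB ω μ l b = 0 := by
    have : coefB ω μ l b * (xF b 0 ^ 2 + yF b 0 ^ 2) = 0 := by
      rw [← hw]; linear_combination yF b t * hN + xF b t * hD
    exact (mul_eq_zero.mp this).resolve_right hne
  obtain ⟨c1, c2⟩ := h.combination_zero hω hl hb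
  have hωc : (ω : ℂ) ≠ 0 := by exact_mod_cast hω.ne'
  have hc : cB ω b ≠ 0 := neg_ne_zero.mpr (mul_ne_zero (mul_ne_zero (by norm_num) hωc) hne)
  rw [hA, hC, zero_mul, zero_mul, add_zero] at c1
  rw [hA, hC, zero_mul, zero_mul, neg_zero, add_zero, eq_comm, neg_eq_zero] at c2
  have m1 := (mul_eq_zero.mp c1.symm).resolve_left hc
  have m2 := (mul_eq_zero.mp c2).resolve_left hc
  have := mOne_mTwo_inv_snd (ω := ω) (μ := μ) (l := l) (b := b)
  rw [m1, m2, mul_zero, mul_zero, add_zero] at this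
  exact mul_ne_zero (cR_sq_sub_cP_sq_ne_zero hω.ne' hDp hDm) (yF_ne_zero _ _) this.symm

end

/-! ### The image of B as a solution pair, and its second iterate. -/

section

variable {ω μ : ℝ} {l : ℕ} {Φ Ψ : ℂ → ℂ} {b : Branches}

theorem IsSolutionPair.isCSys_transform (hω : 0 < ω) (h : IsSolutionPair ω μ l Φ Ψ)
    (hb : b.IsFor ω Φ Ψ) : IsCSys ω μ l (numB ω μ l b) (fun z => -denB ω μ l b z) := by
  have hs := h.isCSys hω hb
  have := hs.linComb (hs.reflect hω) (coefA ω μ l b) (coefB ω μ l b)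
  have e : (fun z => -denB ω μ l b z) = fun z => coefA ω μ l b * rootDiv b z
      + coefB ω μ l b * -rootMul b (1 / z) := funext fun z => by simp only [denB]; ring
  rw [e]
  exact this

theorem IsSolutionPair.denB_circle_ne_zero (hω : 0 < ω) (hl : 0 < l)
    (hDp : Dplus ω μ l ≠ 0) (hDm : Dminus ω μ l ≠ 0) (h : IsSolutionPair ω μ l Φ Ψ)
    (hΦ : Φ 1 ^ 2 ≠ -1) (hb : b.IsFor ω Φ Ψ) {t : ℝ}
    (ht : t ∈ Ioo (-(period ω / 2)) (period ω / 2)) : denB ω μ l b (circlePoint ω t) ≠ 0 := by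
  rw [h.denB_eq_conj hω hl hb ht]
  refine mul_ne_zero (pow_ne_zero _ (by norm_num)) ?_
  rw [Ne, map_eq_zero]
  exact h.numB_circle_ne_zero hω hl hDp hDm hΦ hb ht

theorem IsSolutionPair.rootMul_mul_add (hω : 0 < ω) (h : IsSolutionPair ω μ l Φ Ψ)
    (hb : b.IsFor ω Φ Ψ) : ∀ᶠ z in 𝓝ˢ puncturedCircle,
      rootMul b z * rootMul b (1 / z) + rootDiv b z * rootDiv b (1 / z)
        = xF b 0 ^ 2 + yF b 0 ^ 2 := by
  have hs := h.isCSys hω hb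
  have hr := hs.reflect hω
  have a1 := hr.analytic_snd.mono fun z hz => hz.neg
  refine eventually_eq_of_eq_on_circle hω ?_ (Eventually.of_forall fun _ => analyticAt_const)
    fun t ht => ?_
  · filter_upwards [hs.analytic_fst, hs.analytic_snd, hr.analytic_fst, a1] with z h1 h2 h3 h4
    refine (h1.mul (h4.congr ?_)).add (h2.mul h3)
    exact Eventually.of_forall fun w => by simp
  · rw [one_div, ← circlePoint_neg, hb.rootMul_circle ht, hb.rootDiv_circle ht,
      hb.rootMul_circle (neg_mem_half ht), hb.rootDiv_circle (neg_mem_half ht)]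
    exact h.xF_mul_neg hω hb (Ioo_subset_Icc_self ht)

theorem xF_zero_sq : xF b 0 ^ 2
    = (Real.cos (b.phase 0) : ℂ) + Complex.I * (Real.sin (b.phase 0) : ℂ) := by
  rw [xF, phaseIntegral_zero, ePhase]
  simp only [Complex.ofReal_zero, zero_div, Complex.exp_zero, one_mul]
  rw [← Complex.exp_nat_mul, Complex.ofReal_cos, Complex.ofReal_sin,
    mul_comm Complex.I (Complex.sin _), ← Complex.exp_mul_I]
  congr 1; push_cast; ring

theorem yF_zero_sq : yF b 0 ^ 2
    = (Real.cos (b.phase 0) : ℂ) - Complex.I * (Real.sin (b.phase 0) : ℂ) := by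
  rw [← conj_xF, ← map_pow, xF_zero_sq]
  simp only [map_add, map_mul, Complex.conj_ofReal, Complex.conj_I]
  ring

theorem xF_zero_mul_yF_zero : xF b 0 * yF b 0 = 1 := by
  simp only [xF, yF, phaseIntegral_zero, ePhase, ePhaseInv]
  simp [← Complex.exp_add]

/-- F and G are linear combinations of A and C, chosen so that over a common denominator the
numerator of Θ_B - Θ̃_B is a constant times x(z)x(1/z) + y(z)y(1/z). That sum is the constant 2 cos
φ(0). -/
theorem IsSolutionPair.psiB_eq (hω : 0 < ω) (hl : 0 < l)
    (hDp : Dplus ω μ l ≠ 0) (hDm : Dminus ω μ l ≠ 0) (h : IsSolutionPair ω μ l Φ Ψ)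
    (hΦ : Φ 1 ^ 2 ≠ -1) (hb : b.IsFor ω Φ Ψ) : ∀ᶠ z in 𝓝ˢ puncturedCircle,
      psiB ω μ l b z = -(numB ω μ l b 1 * denB ω μ l b 1)⁻¹
        * (numB ω μ l b z * -denB ω μ l b z) := by
  have hs := h.isCSys_transform hω hb
  have hN := eventually_ne_of_ne_on_circle hω hs.analytic_fst
    fun t ht => h.numB_circle_ne_zero hω hl hDp hDm hΦ hb ht
  have hD := eventually_ne_of_ne_on_circle hω hs.analytic_snd
    fun t ht => neg_ne_zero.mpr (h.denB_circle_ne_zero hω hl hDp hDm hΦ hb ht)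
  have hcos : (Real.cos (b.phase 0) : ℂ) ≠ 0 := by
    have := hb.sq_add_sq_ne_zero hω hΦ
    rw [xF_zero_sq, yF_zero_sq] at this
    intro h0; apply this; rw [h0]; ring
  have hN1 := hb.numB_circle (μ := μ) (l := l) (zero_mem_half hω)
  have hD1 := hb.denB_circle (μ := μ) (l := l) (zero_mem_half hω)
  rw [circlePoint_zero, neg_zero] at hN1 hD1
  filter_upwards [hN, hD, h.rootMul_mul_add hω hb] with z hNz hDz hz
  rw [neg_ne_zero] at hDz
  have hND : numB ω μ l b 1 * denB ω μ l b 1 = coefB ω μ l b ^ 2 - coefA ω μ l b ^ 2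
      + 2 * Complex.I * sinPhase b * coefA ω μ l b * coefB ω μ l b := by
    rw [hN1, hD1, sinPhase]
    linear_combination (coefA ω μ l b * coefB ω μ l b) * (xF_zero_sq (b := b) - yF_zero_sq (b := b))
      + (coefB ω μ l b ^ 2 - coefA ω μ l b ^ 2) * xF_zero_mul_yF_zero (b := b)
  have hG : coefTheta ω μ l b
      = -(sinPhase b * coefB ω μ l b) - Complex.I * coefA ω μ l b := by
    rw [coefTheta, coefA, coefB]
    linear_combination (2 * ePplus ω b * (Dplus ω μ l * coefW b (-1) * coefU ω l b (-1)
      + Dminus ω μ l * coefW b 1 * coefU ω l b 1)) * Complex.I_mul_I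
  have hΘ : thetaB ω μ l b z = ((Real.cos (b.phase 0) : ℂ))⁻¹ *
      (-Complex.I * (-(Complex.I * sinPhase b * coefA ω μ l b) - coefB ω μ l b) * rootDiv b z
        + coefTheta ω μ l b * rootMul b (1 / z)) * (denB ω μ l b z)⁻¹ := by
    rw [thetaB]
    congr 4
    rw [coefA, coefB]
    linear_combination (-Complex.I * 2 * sinPhase b * ePplus ω b * (Dplus ω μ l * coefW b (-1) * coefU ω l b (-1)
      + Dminus ω μ l * coefW b 1 * coefU ω l b 1)) * Complex.I_mul_I
  have hΘ' : thetaTildeB ω μ l b z = ((Real.cos (b.phase 0) : ℂ))⁻¹ *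
      (Complex.I * (-(Complex.I * sinPhase b * coefA ω μ l b) - coefB ω μ l b) * rootMul b z
        + coefTheta ω μ l b * rootDiv b (1 / z)) * (numB ω μ l b z)⁻¹ := by
    rw [thetaTildeB]
    congr 4
    rw [coefA, coefB]
    linear_combination (Complex.I * 2 * sinPhase b * ePplus ω b * (Dplus ω μ l * coefW b (-1) * coefU ω l b (-1)
      + Dminus ω μ l * coefW b 1 * coefU ω l b 1)) * Complex.I_mul_I
  have hdiff : (2 * Complex.I)⁻¹ * (thetaB ω μ l b z - thetaTildeB ω μ l b z)
      = (numB ω μ l b 1 * denB ω μ l b 1) * (numB ω μ l b z * denB ω μ l b z)⁻¹ := by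
    rw [hΘ, hΘ', hG, hND]
    rw [xF_zero_sq, yF_zero_sq] at hz
    have hi := Complex.I_ne_zero
    have hI := Complex.I_mul_I
    field_simp
    rw [numB, denB]
    rw [numB] at hNz
    generalize (Real.cos (b.phase 0) : ℂ) = c at hz hcos ⊢
    generalize (Real.sin (b.phase 0) : ℂ) = s₀ at hz ⊢
    generalize sinPhase b = s
    generalize rootMul b z = x at hz ⊢
    generalize rootDiv b z = y at hz ⊢
    generalize rootMul b (1 / z) = x' at hz ⊢
    generalize rootDiv b (1 / z) = y' at hz ⊢
    generalize coefA ω μ l b = A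
    generalize coefB ω μ l b = B
    linear_combination (Complex.I * (B ^ 2 - A ^ 2) + (Complex.I ^ 2 - 1) * s * A * B) * hz
      - 2 * c * s * A * B * hI
  rw [psiB, hdiff, mul_inv, inv_inv]
  ring

/-- Φ_B is the ratio and Ψ_B a normalised product of the components of a solution of the linear
system, so both equations hold. The modulus at 1 is 1 because numerator and denominator are
conjugate up to sign. -/
theorem IsSolutionPair.transform (hω : 0 < ω) (hl : 0 < l)
    (hDp : Dplus ω μ l ≠ 0) (hDm : Dminus ω μ l ≠ 0) (h : IsSolutionPair ω μ l Φ Ψ)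
    (hΦ : Φ 1 ^ 2 ≠ -1) (hb : b.IsFor ω Φ Ψ) :
    IsSolutionPair ω μ l (phiB ω μ l b) (psiB ω μ l b) := by
  have hs := h.isCSys_transform hω hb
  have hN := eventually_ne_of_ne_on_circle hω hs.analytic_fst
    fun t ht => h.numB_circle_ne_zero hω hl hDp hDm hΦ hb ht
  have hD := eventually_ne_of_ne_on_circle hω hs.analytic_snd
    fun t ht => neg_ne_zero.mpr (h.denB_circle_ne_zero hω hl hDp hDm hΦ hb ht)
  have hφ : ∀ z, phiB ω μ l b z = numB ω μ l b z / -denB ω μ l b z := fun z => by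
    rw [phiB, div_neg, neg_mul, div_eq_mul_inv]
  have hψ := h.psiB_eq hω hl hDp hDm hΦ hb
  have hN1 := h.numB_circle_ne_zero hω hl hDp hDm hΦ hb (zero_mem_half hω)
  have hD1 := h.denB_circle_ne_zero hω hl hDp hDm hΦ hb (zero_mem_half hω)
  have hc := h.denB_eq_conj hω hl hb (zero_mem_half hω)
  have hψ1 := at_circlePoint hω hψ (zero_mem_half hω)
  rw [circlePoint_zero] at hN1 hD1 hc hψ1
  refine ⟨hs.isRiccatiSolution hD (Eventually.of_forall hφ),
    hs.isLinearSolution hω hN hD (Eventually.of_forall hφ) hψ, ?_, ?_⟩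
  · rw [hψ1]; field_simp
  · rw [hφ, norm_div, norm_neg, hc, norm_mul, norm_pow, norm_neg, norm_one, one_pow, one_mul,
      Complex.norm_conj, div_self (norm_ne_zero_iff.mpr hN1)]

/-! ### Boundary values -/

theorem eventually_left_mem (hω : 0 < ω) :
    ∀ᶠ t in 𝓝[<] (period ω / 2), t ∈ Ioo (-(period ω / 2)) (period ω / 2) :=
  Ioo_mem_nhdsLT (by linarith [half_period_pos hω])

theorem eventually_right_mem (hω : 0 < ω) :
    ∀ᶠ t in 𝓝[>] (-(period ω / 2)), t ∈ Ioo (-(period ω / 2)) (period ω / 2) :=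
  Ioo_mem_nhdsGT (by linarith [half_period_pos hω])

theorem tendsto_left (hω : 0 < ω) {f : ℝ → ℂ}
    (hf : ContinuousOn f (Icc (-(period ω / 2)) (period ω / 2))) :
    Tendsto f (𝓝[<] (period ω / 2)) (𝓝 (f (period ω / 2))) := by
  have hτ := half_period_pos hω
  have := hf (period ω / 2) ⟨by linarith, le_rfl⟩
  exact this.mono_left (nhdsWithin_le_of_mem
    (mem_of_superset (Ioo_mem_nhdsLT (show -(period ω / 2) < period ω / 2 by linarith))
      Ioo_subset_Icc_self))

theorem tendsto_right (hω : 0 < ω) {f : ℝ → ℂ}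
    (hf : ContinuousOn f (Icc (-(period ω / 2)) (period ω / 2))) :
    Tendsto f (𝓝[>] (-(period ω / 2))) (𝓝 (f (-(period ω / 2)))) := by
  have hτ := half_period_pos hω
  have := hf (-(period ω / 2)) ⟨le_rfl, by linarith⟩
  exact this.mono_left (nhdsWithin_le_of_mem
    (mem_of_superset (Ioo_mem_nhdsGT (show -(period ω / 2) < period ω / 2 by linarith))
      Ioo_subset_Icc_self))

theorem IsSolutionPair.tendsto_transform (hω : 0 < ω) (hl : 0 < l)
    (h : IsSolutionPair ω μ l Φ Ψ) (hb : b.IsFor ω Φ Ψ) :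
    Tendsto (fun t => numB ω μ l b (circlePoint ω t)) (𝓝[>] (-(period ω / 2)))
      (𝓝 (cB ω b * ((-1) ^ (l + 1) * Complex.I * cP ω μ l * xF b 0
        + (-1) ^ (l + 1) * cR ω μ l * yF b 0))) ∧
    Tendsto (fun t => denB ω μ l b (circlePoint ω t)) (𝓝[>] (-(period ω / 2)))
      (𝓝 (-(cB ω b * (-(cR ω μ l : ℂ) * xF b 0 + Complex.I * cP ω μ l * yF b 0)))) := by
  obtain ⟨e1, e2⟩ := h.combination_end hω hl hb
  have hs := h.isSys hω hb
  have hm : MapsTo (fun s : ℝ => -s) (Icc (-(period ω / 2)) (period ω / 2))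
      (Icc (-(period ω / 2)) (period ω / 2)) :=
    fun s hs => ⟨by linarith [hs.2], by linarith [hs.1]⟩
  have hx' : ContinuousOn (fun t => xF b (-t)) _ := hs.cont_fst.comp continuousOn_neg hm
  have hy' : ContinuousOn (fun t => yF b (-t)) _ := hs.cont_snd.comp continuousOn_neg hm
  have t1 := tendsto_right hω ((continuousOn_const (c := coefA ω μ l b)).mul hs.cont_fst |>.add
    ((continuousOn_const (c := coefB ω μ l b)).mul hy'))
  have t2 := tendsto_right hω ((continuousOn_const (c := coefA ω μ l b)).mul hs.cont_snd |>.neg.add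
    ((continuousOn_const (c := coefB ω μ l b)).mul hx'))
  simp only [Pi.add_apply, Pi.mul_apply, Pi.neg_apply, neg_neg] at t1 t2
  rw [← e1, ← e2]
  refine ⟨t1.congr' ?_, t2.congr' ?_⟩
  · filter_upwards [eventually_right_mem hω] with t ht using (hb.numB_circle ht).symm
  · filter_upwards [eventually_right_mem hω] with t ht using (hb.denB_circle ht).symm

theorem IsSolutionPair.values_at_one (hω : 0 < ω) (hl : 0 < l) (h : IsSolutionPair ω μ l Φ Ψ)
    (hb : b.IsFor ω Φ Ψ) : numB ω μ l b 1 = cB ω b * mOne ω μ l b ∧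
      denB ω μ l b 1 = -(cB ω b * mTwo ω μ l b) := by
  have e1 := hb.numB_circle (μ := μ) (l := l) (zero_mem_half hω)
  have e2 := hb.denB_circle (μ := μ) (l := l) (zero_mem_half hω)
  rw [circlePoint_zero, neg_zero] at e1 e2
  rw [e1, e2]
  exact h.combination_zero hω hl hb

theorem IsSolutionPair.isMonodromyImage (hω : 0 < ω) (hl : 0 < l)
    (hDp : Dplus ω μ l ≠ 0) (hDm : Dminus ω μ l ≠ 0) (h : IsSolutionPair ω μ l Φ Ψ)
    (hΦ : Φ 1 ^ 2 ≠ -1) (hb : b.IsFor ω Φ Ψ) (hΦB : phiB ω μ l b 1 ^ 2 ≠ -1) {b' : Branches}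
    (hb' : b'.IsFor ω (phiB ω μ l b) (psiB ω μ l b)) :
    IsMonodromyImage ω μ l Φ Ψ (phiB ω μ l b') (psiB ω μ l b') := by
  have h' := h.transform hω hl hDp hDm hΦ hb
  have h'' := h'.transform hω hl hDp hDm hΦB hb'
  have hωc : (ω : ℂ) ≠ 0 := by exact_mod_cast hω.ne'
  have h0 := zero_mem_half hω
  have hD1 := h.denB_circle_ne_zero hω hl hDp hDm hΦ hb h0
  have hN1' := h'.numB_circle_ne_zero hω hl hDp hDm hΦB hb' h0
  have hD1' := h'.denB_circle_ne_zero hω hl hDp hDm hΦB hb' h0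
  rw [circlePoint_zero] at hD1 hN1' hD1'
  obtain ⟨v1, v2⟩ := h.values_at_one hω hl hb
  have hc : cB ω b ≠ 0 := fun h0 => by rw [v2, h0] at hD1; simp at hD1
  have hm2 : mTwo ω μ l b ≠ 0 := fun h0 => by rw [v2, h0] at hD1; simp at hD1
  have hc' : cB ω b' ≠ 0 := neg_ne_zero.mpr (mul_ne_zero (mul_ne_zero (by norm_num) hωc)
    (hb'.sq_add_sq_ne_zero hω hΦB))
  -- The new half-powers at z = 1 are known only through their ratio Φ_B(1), which is `mOne` /
  -- `mTwo`. The unknown common factor s cancels in the end.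
  obtain ⟨s, hs0, hsx, hsy⟩ : ∃ s : ℂ, s ≠ 0 ∧ xF b' 0 = s * mOne ω μ l b
      ∧ yF b' 0 = s * mTwo ω μ l b := by
    refine ⟨yF b' 0 / mTwo ω μ l b, div_ne_zero (yF_ne_zero _ _) hm2, ?_, by field_simp⟩
    have := hb'.xF_eq h0
    rw [circlePoint_zero, phiB, v1, v2] at this
    rw [this]
    field_simp
  obtain ⟨t1, t2⟩ := h'.tendsto_transform hω hl hb'
  -- At e^{-iπ} the second transform tends to k times the original vector at e^{iπ}. The ratio loses
  -- k, while the product carries k², whence the factor κ below.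
  set k : ℂ := cB ω b' * s * ((cR ω μ l : ℂ) ^ 2 - (cP ω μ l : ℂ) ^ 2) with hk
  have hk0 : k ≠ 0 := mul_ne_zero (mul_ne_zero hc' hs0)
    (cR_sq_sub_cP_sq_ne_zero hω.ne' hDp hDm)
  have e1 : cB ω b' * ((-1) ^ (l + 1) * Complex.I * cP ω μ l * xF b' 0
      + (-1) ^ (l + 1) * cR ω μ l * yF b' 0) = k * xF b (period ω / 2) := by
    rw [hk, hsx, hsy]
    linear_combination (cB ω b' * s) * mOne_mTwo_inv_fst (ω := ω) (μ := μ) (l := l) (b := b)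
  have e2 : -(cB ω b' * (-(cR ω μ l : ℂ) * xF b' 0 + Complex.I * cP ω μ l * yF b' 0))
      = -(k * yF b (period ω / 2)) := by
    rw [hk, hsx, hsy]
    linear_combination (-(cB ω b' * s)) * mOne_mTwo_inv_snd (ω := ω) (μ := μ) (l := l) (b := b)
  rw [e1] at t1
  rw [e2] at t2
  have hx := xF_ne_zero b (period ω / 2)
  have hy := yF_ne_zero b (period ω / 2)
  have hsys := h.isSys hω hb
  have tx := tendsto_left hω hsys.cont_fst
  have ty := tendsto_left hω hsys.cont_snd
  refine ⟨h''.riccati, ⟨xF b (period ω / 2) / yF b (period ω / 2), ?_, ?_⟩, h''.linear,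
    ⟨-(numB ω μ l b' 1 * denB ω μ l b' 1) / k ^ 2, ?_,
      xF b (period ω / 2) * yF b (period ω / 2), ?_, ?_⟩, h''.psi_one⟩
  · refine (tx.div ty hy).congr' ?_
    filter_upwards [eventually_left_mem hω] with t ht
    rw [Pi.div_apply, hb.xF_eq ht, mul_div_cancel_right₀ _ (yF_ne_zero b t)]
  · have := t1.neg.mul (t2.inv₀ (neg_ne_zero.mpr (mul_ne_zero hk0 hy)))
    have e3 : -(k * xF b (period ω / 2)) * (-(k * yF b (period ω / 2)))⁻¹
        = xF b (period ω / 2) / yF b (period ω / 2) := by field_simp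
    rw [e3] at this
    exact this
  · exact div_ne_zero (neg_ne_zero.mpr (mul_ne_zero hN1' hD1')) (pow_ne_zero 2 hk0)
  · refine (tx.mul ty).congr' ?_
    filter_upwards [eventually_left_mem hω] with t ht using hb.xF_mul_yF hω ht
  · have hψ := h'.psiB_eq hω hl hDp hDm hΦB hb'
    have := ((t1.mul t2.neg).const_mul (k ^ 2)⁻¹)
    have e3 : (k ^ 2)⁻¹ * (k * xF b (period ω / 2) * - -(k * yF b (period ω / 2)))
        = xF b (period ω / 2) * yF b (period ω / 2) := by field_simp
    rw [e3] at this
    refine this.congr' ?_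
    filter_upwards [eventually_right_mem hω] with t ht
    rw [at_circlePoint hω hψ ht]
    field_simp

/-- A solution of the Riccati equation is determined by its boundary value. -/
theorem IsRiccatiSolution.eq_of_tendsto (hω : 0 < ω) {Φ₁ Φ₂ : ℂ → ℂ} {c : ℂ}
    (h1 : IsRiccatiSolution ω μ l Φ₁) (h2 : IsRiccatiSolution ω μ l Φ₂)
    (t1 : Tendsto (fun t : ℝ => Φ₁ (circlePoint ω t)) (𝓝[>] (-(period ω / 2))) (𝓝 c))
    (t2 : Tendsto (fun t : ℝ => Φ₂ (circlePoint ω t)) (𝓝[>] (-(period ω / 2))) (𝓝 c))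
    {t : ℝ} (ht : t ∈ Ioo (-(period ω / 2)) (period ω / 2)) :
    Φ₁ (circlePoint ω t) = Φ₂ (circlePoint ω t) := by
  set τ := period ω / 2 with hτ
  have hsub : Icc (-τ) t ⊆ Ico (-τ) τ := fun s hs => ⟨hs.1, hs.2.trans_lt ht.2⟩
  -- The solutions are extended continuously to the excluded endpoint by the value c. Their
  -- difference then solves a linear equation with bounded coefficient and starts at zero.
  have hext : ∀ {F : ℂ → ℂ}, IsRiccatiSolution ω μ l F →
      Tendsto (fun t : ℝ => F (circlePoint ω t)) (𝓝[>] (-τ)) (𝓝 c) →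
      ContinuousOn (Function.update (fun t => F (circlePoint ω t)) (-τ) c) (Icc (-τ) t) := by
    intro F hF hT
    apply ContinuousOn.mono _ hsub
    rw [continuousOn_update_iff]
    refine ⟨?_, fun _ => ?_⟩
    · intro s hs
      have hs' : s ∈ Ioo (-τ) τ := ⟨lt_of_le_of_ne hs.1.1 (Ne.symm hs.2), hs.1.2⟩
      exact (hF.hasDerivAt_circle hω hs').continuousAt.continuousWithinAt
    · rw [Ico_sdiff_left]
      exact hT.mono_left (nhdsWithin_mono _ Ioo_subset_Ioi_self)
  have c1 := hext h1 t1
  have c2 := hext h2 t2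
  obtain ⟨M, hM⟩ := isCompact_Icc.exists_bound_of_continuousOn
    (f := fun s => -(1 / 2) * (Function.update (fun t => Φ₁ (circlePoint ω t)) (-τ) c s
      + Function.update (fun t => Φ₂ (circlePoint ω t)) (-τ) c s) + Complex.I * drive ω μ l s)
    ((continuousOn_const.mul (c1.add c2)).add
      (continuousOn_const.mul continuous_drive.continuousOn))
  have hne : ∀ s ∈ Ioo (-τ) t, s ≠ -τ := fun s hs => hs.1.ne'
  have hz := eq_zero_of_linear_of_left (c1.sub c2)
    (k := fun s => -(1 / 2) * (Function.update (fun t => Φ₁ (circlePoint ω t)) (-τ) c s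
      + Function.update (fun t => Φ₂ (circlePoint ω t)) (-τ) c s) + Complex.I * drive ω μ l s)
    (M := M) (fun s hs => by
      have hs' : s ∈ Ioo (-τ) τ := ⟨hs.1, hs.2.trans ht.2⟩
      have hd := (h1.hasDerivAt_circle hω hs').sub (h2.hasDerivAt_circle hω hs')
      simp only [Pi.sub_apply]
      rw [Function.update_of_ne (hne s hs), Function.update_of_ne (hne s hs)]
      refine (hd.congr_of_eventuallyEq ?_).congr_deriv (by ring)
      filter_upwards [isOpen_ne.mem_nhds (hne s hs)] with u hu
      simp [Function.update_of_ne hu])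
    (fun s hs => hM s (Ioo_subset_Icc_self hs)) (by simp)
    (right_mem_Icc.mpr ht.1.le)
  simp only [Pi.sub_apply] at hz
  rw [Function.update_of_ne ht.1.ne', Function.update_of_ne ht.1.ne'] at hz
  exact sub_eq_zero.mp hz

/-- Φ_M is determined by its boundary value, and Ψ_M by its linear equation with value 1 at z = 1.
Equality on the circle extends to a vicinity by the identity theorem. -/
theorem IsMonodromyImage.unique (hω : 0 < ω) {Φ₁ Ψ₁ Φ₂ Ψ₂ : ℂ → ℂ}
    (h1 : IsMonodromyImage ω μ l Φ Ψ Φ₁ Ψ₁) (h2 : IsMonodromyImage ω μ l Φ Ψ Φ₂ Ψ₂) :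
    ∀ᶠ z in 𝓝ˢ puncturedCircle, Φ₁ z = Φ₂ z ∧ Ψ₁ z = Ψ₂ z := by
  have hφ : ∀ t ∈ Ioo (-(period ω / 2)) (period ω / 2),
      Φ₁ (circlePoint ω t) = Φ₂ (circlePoint ω t) := by
    obtain ⟨c1, s1, t1⟩ := h1.continues_phi
    obtain ⟨c2, s2, t2⟩ := h2.continues_phi
    obtain rfl : c1 = c2 := by
      have : (𝓝[<] (period ω / 2)).NeBot := inferInstance
      exact tendsto_nhds_unique s1 s2
    exact fun t ht => h1.riccati.eq_of_tendsto hω h2.riccati t1 t2 ht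
  have hψ : ∀ t ∈ Ioo (-(period ω / 2)) (period ω / 2),
      Ψ₁ (circlePoint ω t) = Ψ₂ (circlePoint ω t) := by
    intro t ht
    have hc : ContinuousOn (fun t => Φ₁ (circlePoint ω t))
        (Ioo (-(period ω / 2)) (period ω / 2)) :=
      fun s hs => (h1.riccati.hasDerivAt_circle hω hs).continuousAt.continuousWithinAt
    have hz := eq_zero_of_linear (zero_mem_half hω)
      (d := fun t => Ψ₁ (circlePoint ω t) - Ψ₂ (circlePoint ω t))
      (k := fun t => 1 / 2 * (Φ₁ (circlePoint ω t) + (Φ₁ (circlePoint ω t))⁻¹))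
      (fun s hs => by
        have d2 := (h2.linear.hasDerivAt_circle hω hs).2
        rw [← hφ s hs] at d2
        exact ((h1.linear.hasDerivAt_circle hω hs).2.sub d2).congr_deriv (by ring))
      (continuousOn_const.mul (hc.add (hc.inv₀ fun s hs =>
        (h1.linear.hasDerivAt_circle hω hs).1)))
      (by simp [circlePoint_zero, h1.psi_one, h2.psi_one]) ht
    exact sub_eq_zero.mp hz
  exact (eventually_eq_of_eq_on_circle hω h1.riccati.analytic h2.riccati.analytic hφ).and
    (eventually_eq_of_eq_on_circle hω h1.linear.analytic h2.linear.analytic hψ)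

end

end RSJ


theorem mainTheorem2 (ω μ : ℝ) (l : ℕ) (hω : 0 < ω) (hl : 0 < l)
    (hDp : RSJ.Dplus ω μ l ≠ 0) (hDm : RSJ.Dminus ω μ l ≠ 0)
    (Φ Ψ : ℂ → ℂ) (h : RSJ.IsSolutionPair ω μ l Φ Ψ) (hΦ : Φ 1 ^ 2 ≠ -1) :
    (∃ ΦB ΨB : ℂ → ℂ, RSJ.IsBTransform ω μ l Φ Ψ ΦB ΨB) ∧
    ∀ ΦB ΨB : ℂ → ℂ, RSJ.IsBTransform ω μ l Φ Ψ ΦB ΨB →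
      RSJ.IsSolutionPair ω μ l ΦB ΨB ∧
      (ΦB 1 ^ 2 ≠ -1 →
        (∃ ΦBB ΨBB : ℂ → ℂ, RSJ.IsBTransform ω μ l ΦB ΨB ΦBB ΨBB) ∧
        ∀ ΦBB ΨBB : ℂ → ℂ, RSJ.IsBTransform ω μ l ΦB ΨB ΦBB ΨBB →
          RSJ.IsMonodromyImage ω μ l Φ Ψ ΦBB ΨBB ∧
          ∀ ΦM ΨM : ℂ → ℂ, RSJ.IsMonodromyImage ω μ l Φ Ψ ΦM ΨM →
            ∀ᶠ z in 𝓝ˢ RSJ.puncturedCircle, ΦBB z = ΦM z ∧ ΨBB z = ΨM z) := by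
  obtain ⟨b₀, hb₀⟩ := h.exists_branches hω
  refine ⟨⟨_, _, b₀, hb₀, rfl, rfl⟩, ?_⟩
  rintro _ _ ⟨b, hb, rfl, rfl⟩
  have h' := h.transform hω hl hDp hDm hΦ hb
  refine ⟨h', fun hΦB => ?_⟩
  obtain ⟨b₁, hb₁⟩ := h'.exists_branches hω
  refine ⟨⟨_, _, b₁, hb₁, rfl, rfl⟩, ?_⟩
  rintro _ _ ⟨b', hb', rfl, rfl⟩
  have hM := h.isMonodromyImage hω hl hDp hDm hΦ hb hΦB hb'
  exact ⟨hM, fun ΦM ΨM hM' => hM.unique hω hM'⟩
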